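/- Let $\Gamma=SL(2,\mathbb Z)$ act on integral binary cubic forms by $(\gamma x)(u,v)=x((u,v)\gamma)$, let $n$ be a non-zero integer, and let $L^\vee(n)$ be the $\Gamma$-stable set of forms $x(u,v)=x_0u^3+x_1u^2v+x_2uv^2+x_3v^3$ with $x_i\in\mathbb Z$, $3\mid x_1$, $3\mid x_2$ and discriminant $$x_1^2x_2^2+18x_0x_1x_2x_3-4x_0x_2^3-4x_1^3x_3-27x_0^2x_3^2=-27n.$$ Let $k=\mathbb Q(\sqrt n)$ if $n$ is not the square of an integer, and $k=\mathbb Q\oplus\mathbb Q$ otherwise. Let $\tau$ be the non-trivial automorphism of $k$, let $\mathcal O_k$ be its maximal order and $\Delta_k$ its discriminant (so $\Delta_k=1$ if $k=\mathbb Q\oplus\mathbb Q$). Let $\sqrt{\Delta_k}\in k$ be a fixed square root of $\Delta_k$ (either one) if $k$ is a field, and $\sqrt{\Delta_k}=(-1,1)$ if $k=\mathbb Q\oplus\mathbb Q$. For an integer $c\ge 1$ let $\mathcal O_{k,c}=\mathbb Z\,1+c\,\mathcal O_k$. For an invertible (fractional) $\mathcal O_{k,c}$-ideal $\mathfrak a$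 let $\mathbf N\mathfrak a$ denote its norm, i.e. the index $[\mathcal O_{k,c}:\mathfrak a]$ if $\mathfrak a\subseteq\mathcal O_{k,c}$, extended multiplicatively to all invertible ideals. For integers $b,c\ge1$ let $S_k(b,c)$ be the set of pairs $(\mathfrak a,\beta)$, where $\mathfrak a$ is an invertible $\mathcal O_{k,c}$-ideal, $\beta\in\mathfrak a^3$ and $\mathbf N(\beta\mathfrak a^{-3})=b$. Call $(\mathfrak a_1,\beta_1)$ and $(\mathfrak a_2,\beta_2)$ in $S_k(b,c)$ equivalent if there is $\rho\in k^*$ with $\rho\mathfrak a_1=\mathfrak a_2$ and $\rho^3\beta_1=\beta_2$, and write $[\mathfrak a,\beta]$ for the class of $(\mathfrak a,\beta)$. Let $$S(n)=\bigsqcup_{b,c\ge 1,\ (bc)^2\Delta_k=n} S_k(b,c)/\!\sim .$$ **Theorem.** Let $(\mathfrak a,\beta)\in S_k(b,c)$ with $(bc)^2\Delta_k=n$. Then $\mathfrak a$ has a $\mathbb Z$-basis $\alpha_1,\alpha_2$ with $$\mathrm N_{k/\mathbb Q}(\beta)\,(\alpha_1\alpha_2^\tau-\alpha_2\alpha_1^\tau)/\sqrt{\Delta_k}<0,$$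 and for every such basis the form $$x(u,v)=\mathrm{Tr}_{k/\mathbb Q}\!\left(\frac{\beta\,(\alpha_1^\tau u+\alpha_2^\tau v)^3}{c\sqrt{\Delta_k}\,(\mathbf N\mathfrak a)^3}\right)$$ lies in $L^\vee(n)$; its $\Gamma$-orbit depends only on $[\mathfrak a,\beta]$, and not on the choice of the representative or of the basis. The resulting map $$\Psi_n:S(n)\to\Gamma\backslash L^\vee(n),\qquad [\mathfrak a,\beta]\mapsto\Gamma\cdot x(u,v),$$ is a bijection. -/

import Mathlib

open scoped MatrixGroups

namespace OhnoNakagawa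

/-! ### Integral binary cubic forms -/

/-- The lattice `L` of integral binary cubic forms
`x(u,v) = x₀ u³ + x₁ u² v + x₂ u v² + x₃ v³`, given by their coefficients. -/
@[ext]
structure CubicForm where
  x0 : ℤ
  x1 : ℤ
  x2 : ℤ
  x3 : ℤ

namespace CubicForm

/-- The value `x(u,v)` in a commutative ring. -/
def eval {R : Type*} [CommRing R] (x : CubicForm) (u v : R) : R :=
  (x.x0 : R) * u ^ 3 + (x.x1 : R) * u ^ 2 * v + (x.x2 : R) * u * v ^ 2 + (x.x3 : R) * v ^ 3

/-- The discriminant of a binary cubic form. -/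
def disc (x : CubicForm) : ℤ :=
  x.x1 ^ 2 * x.x2 ^ 2 + 18 * x.x0 * x.x1 * x.x2 * x.x3
    - 4 * x.x0 * x.x2 ^ 3 - 4 * x.x1 ^ 3 * x.x3 - 27 * x.x0 ^ 2 * x.x3 ^ 2

/-- The form `x((u,v) γ)`, i.e. `x(γ₀₀ u + γ₁₀ v, γ₀₁ u + γ₁₁ v)`; see `eval_smul`. -/
instance : SMul SL(2, ℤ) CubicForm where
  smul γ x :=
    { x0 := x.x0 * γ 0 0 ^ 3 + x.x1 * γ 0 0 ^ 2 * γ 0 1 + x.x2 * γ 0 0 * γ 0 1 ^ 2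
        + x.x3 * γ 0 1 ^ 3
      x1 := 3 * x.x0 * γ 0 0 ^ 2 * γ 1 0
        + x.x1 * (γ 0 0 ^ 2 * γ 1 1 + 2 * γ 0 0 * γ 0 1 * γ 1 0)
        + x.x2 * (2 * γ 0 0 * γ 0 1 * γ 1 1 + γ 0 1 ^ 2 * γ 1 0)
        + 3 * x.x3 * γ 0 1 ^ 2 * γ 1 1
      x2 := 3 * x.x0 * γ 0 0 * γ 1 0 ^ 2
        + x.x1 * (2 * γ 0 0 * γ 1 0 * γ 1 1 + γ 0 1 * γ 1 0 ^ 2)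
        + x.x2 * (γ 0 0 * γ 1 1 ^ 2 + 2 * γ 0 1 * γ 1 0 * γ 1 1)
        + 3 * x.x3 * γ 0 1 * γ 1 1 ^ 2
      x3 := x.x0 * γ 1 0 ^ 3 + x.x1 * γ 1 0 ^ 2 * γ 1 1 + x.x2 * γ 1 0 * γ 1 1 ^ 2
        + x.x3 * γ 1 1 ^ 3 }

theorem smul_def (γ : SL(2, ℤ)) (x : CubicForm) : γ • x =
    { x0 := x.x0 * γ 0 0 ^ 3 + x.x1 * γ 0 0 ^ 2 * γ 0 1 + x.x2 * γ 0 0 * γ 0 1 ^ 2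
        + x.x3 * γ 0 1 ^ 3
      x1 := 3 * x.x0 * γ 0 0 ^ 2 * γ 1 0
        + x.x1 * (γ 0 0 ^ 2 * γ 1 1 + 2 * γ 0 0 * γ 0 1 * γ 1 0)
        + x.x2 * (2 * γ 0 0 * γ 0 1 * γ 1 1 + γ 0 1 ^ 2 * γ 1 0)
        + 3 * x.x3 * γ 0 1 ^ 2 * γ 1 1
      x2 := 3 * x.x0 * γ 0 0 * γ 1 0 ^ 2
        + x.x1 * (2 * γ 0 0 * γ 1 0 * γ 1 1 + γ 0 1 * γ 1 0 ^ 2)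
        + x.x2 * (γ 0 0 * γ 1 1 ^ 2 + 2 * γ 0 1 * γ 1 0 * γ 1 1)
        + 3 * x.x3 * γ 0 1 * γ 1 1 ^ 2
      x3 := x.x0 * γ 1 0 ^ 3 + x.x1 * γ 1 0 ^ 2 * γ 1 1 + x.x2 * γ 1 0 * γ 1 1 ^ 2
        + x.x3 * γ 1 1 ^ 3 } := rfl

/-- `(γ x)(u,v) = x((u,v) γ)`. -/
theorem eval_smul {R : Type*} [CommRing R] (γ : SL(2, ℤ)) (x : CubicForm) (u v : R) :
    (γ • x).eval u v =
      x.eval ((γ 0 0 : R) * u + (γ 1 0 : R) * v) ((γ 0 1 : R) * u + (γ 1 1 : R) * v) := by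
  simp only [smul_def, eval]
  push_cast
  ring

instance : MulAction SL(2, ℤ) CubicForm where
  one_smul x := by
    ext <;> simp [smul_def]
  mul_smul γ δ x := by
    ext <;>
      simp only [smul_def, Matrix.SpecialLinearGroup.coe_mul, Matrix.mul_apply,
        Fin.sum_univ_two] <;> ring

theorem disc_smul (γ : SL(2, ℤ)) (x : CubicForm) : (γ • x).disc = x.disc := by
  have h : γ 0 0 * γ 1 1 - γ 0 1 * γ 1 0 = 1 := by
    rw [← Matrix.det_fin_two]
    exact γ.det_coe
  have key : (γ • x).disc = (γ 0 0 * γ 1 1 - γ 0 1 * γ 1 0) ^ 6 * x.disc := by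
    simp only [smul_def, disc]
    ring
  rw [key, h]
  ring

end CubicForm

/-- `L^∨(n)`: the integral binary cubic forms with `x₁, x₂ ∈ 3ℤ` and discriminant `-27 n`,
as a `SL(2,ℤ)`-stable set of forms. -/
def dualForms (n : ℤ) : SubMulAction SL(2, ℤ) CubicForm where
  carrier := {x | (3 : ℤ) ∣ x.x1 ∧ (3 : ℤ) ∣ x.x2 ∧ x.disc = -27 * n}
  smul_mem' γ x hx := by
    obtain ⟨⟨y, hy⟩, ⟨z, hz⟩, hd⟩ := hx
    refine ⟨?_, ?_, by rw [CubicForm.disc_smul, hd]⟩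
    · refine ⟨x.x0 * γ 0 0 ^ 2 * γ 1 0
        + y * (γ 0 0 ^ 2 * γ 1 1 + 2 * γ 0 0 * γ 0 1 * γ 1 0)
        + z * (2 * γ 0 0 * γ 0 1 * γ 1 1 + γ 0 1 ^ 2 * γ 1 0)
        + x.x3 * γ 0 1 ^ 2 * γ 1 1, ?_⟩
      simp only [CubicForm.smul_def, hy, hz]
      ring
    · refine ⟨x.x0 * γ 0 0 * γ 1 0 ^ 2
        + y * (2 * γ 0 0 * γ 1 0 * γ 1 1 + γ 0 1 * γ 1 0 ^ 2)
        + z * (γ 0 0 * γ 1 1 ^ 2 + 2 * γ 0 1 * γ 1 0 * γ 1 1)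
        + x.x3 * γ 0 1 * γ 1 1 ^ 2, ?_⟩
      simp only [CubicForm.smul_def, hy, hz]
      ring

/-- The set of orbits `Γ \ L^∨(n)`, with `Γ = SL(2,ℤ)`. -/
abbrev DualOrbits (n : ℤ) : Type :=
  MulAction.orbitRel.Quotient SL(2, ℤ) (dualForms n)

/-! ### Quadratic orders and their ideals

Here `k` is a commutative `ℚ`-algebra (in the application, a quadratic étale algebra).
Products of `ℤ`-submodules of `k` are the usual ones, spanned by the products of elements. -/

section Ideals

variable (k : Type*) [CommRing k]

/-- The order `O_{k,c} = ℤ 1 + c O_k` of conductor `c`, where `O_k` is the maximal order of `k`. -/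
def quadOrder (c : ℕ) : Subalgebra ℤ k where
  carrier := {x | ∃ m : ℤ, ∃ y ∈ integralClosure ℤ k, x = (m : k) + (c : k) * y}
  mul_mem' := by
    rintro _ _ ⟨m, y, hy, rfl⟩ ⟨m', y', hy', rfl⟩
    refine ⟨m * m', (m : k) * y' + (m' : k) * y + (c : k) * (y * y'), ?_, ?_⟩
    · refine add_mem (add_mem (mul_mem (intCast_mem _ m) hy') (mul_mem (intCast_mem _ m') hy))
        (mul_mem (natCast_mem _ c) (mul_mem hy hy'))
    · push_cast
      ring
  add_mem' := by
    rintro _ _ ⟨m, y, hy, rfl⟩ ⟨m', y', hy', rfl⟩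
    refine ⟨m + m', y + y', add_mem hy hy', ?_⟩
    push_cast
    ring
  algebraMap_mem' r := ⟨r, 0, zero_mem _, by simp⟩

/-- The order `O_{k,c}` as a `ℤ`-submodule of `k`. -/
def quadOrderModule (c : ℕ) : Submodule ℤ k :=
  Subalgebra.toSubmodule (quadOrder k c)

variable {k}

/-- The multiple `ρ 𝔞 = {ρ x | x ∈ 𝔞}`. -/
def scale (ρ : k) (a : Submodule ℤ k) : Submodule ℤ k :=
  a.map (LinearMap.mulLeft ℤ ρ)

/-- The norm `N 𝔞 = [O : 𝔞]` of an ideal `𝔞` of the order `O`, extended to fractional ideals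
as the generalized index `[O : 𝔞 ∩ O] / [𝔞 : 𝔞 ∩ O]`. -/
noncomputable def idealNorm (O a : Submodule ℤ k) : ℚ :=
  (a.toAddSubgroup.relIndex O.toAddSubgroup : ℚ) /
    (O.toAddSubgroup.relIndex a.toAddSubgroup : ℚ)

/-- For an integral ideal the norm is the index. -/
theorem idealNorm_of_le {O a : Submodule ℤ k} (h : a ≤ O) :
    idealNorm O a = (a.toAddSubgroup.relIndex O.toAddSubgroup : ℚ) := by
  have h1 : O.toAddSubgroup.relIndex a.toAddSubgroup = 1 :=
    AddSubgroup.relIndex_eq_one.mpr h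
  simp [idealNorm, h1]

variable [Algebra ℚ k]

/-- A full `ℤ`-module of `k`: finitely generated, with `ℤ`-rank equal to `dim_ℚ k`. -/
def IsFull (a : Submodule ℤ k) : Prop :=
  a.FG ∧ Module.finrank ℤ a = Module.finrank ℚ k

/-- A fractional ideal of the order `O`: a full `ℤ`-module `𝔞` with `O 𝔞 = 𝔞`. -/
def IsFracIdeal (O a : Submodule ℤ k) : Prop :=
  IsFull a ∧ O * a = a

/-- An invertible fractional ideal of the order `O`. -/
def IsInvertibleIdeal (O a : Submodule ℤ k) : Prop :=
  IsFracIdeal O a ∧ ∃ b : Submodule ℤ k, IsFracIdeal O b ∧ a * b = O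

end Ideals

/-- The inverse `𝔞⁻¹ = {x ∈ k | x 𝔞 ⊆ O}` of an invertible ideal `𝔞` of the order `O`. -/
def invIdeal {k : Type*} [CommRing k] (O a : Submodule ℤ k) : Submodule ℤ k :=
  O / a

/-- For an invertible ideal, `invIdeal O 𝔞` is the inverse in the group of invertible ideals. -/
theorem invIdeal_eq_of_mul_eq {k : Type*} [CommRing k] [Algebra ℚ k] {O a b : Submodule ℤ k}
    (h1 : (1 : k) ∈ O) (hb : IsFracIdeal O b) (hab : a * b = O) : invIdeal O a = b := by
  apply le_antisymm
  · intro x hx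
    have hxa : Submodule.span ℤ {x} * a ≤ O := by
      refine Submodule.mul_le.mpr fun y hy z hz => ?_
      obtain ⟨m, rfl⟩ := Submodule.mem_span_singleton.mp hy
      rw [smul_mul_assoc]
      exact O.smul_mem m (Submodule.mem_div_iff_forall_mul_mem.mp hx z hz)
    have h2 : Submodule.span ℤ {x} * O ≤ b := by
      rw [← hab, ← mul_assoc]
      exact (mul_le_mul' hxa le_rfl).trans_eq hb.2
    simpa using h2 (Submodule.mul_mem_mul (Submodule.mem_span_singleton_self x) h1)
  · intro x hx
    refine Submodule.mem_div_iff_forall_mul_mem.mpr fun y hy => ?_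
    rw [← hab, mul_comm x y]
    exact Submodule.mul_mem_mul hy hx

/-! ### The pairs `(𝔞, β)` and their equivalence classes -/

/-- `S_k(b,c)`: the pairs `(𝔞, β)` with `𝔞` an invertible `O_{k,c}`-ideal, `β ∈ 𝔞³` and
`N(β 𝔞⁻³) = b`. -/
def PairSet (k : Type*) [CommRing k] [Algebra ℚ k] (b c : ℕ) : Set (Submodule ℤ k × k) :=
  {p | IsInvertibleIdeal (quadOrderModule k c) p.1 ∧ p.2 ∈ p.1 ^ 3 ∧
    idealNorm (quadOrderModule k c)
      (scale p.2 (invIdeal (quadOrderModule k c) p.1 ^ 3)) = (b : ℚ)}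

/-- `(𝔞₁, β₁) ∼ (𝔞₂, β₂)` if `ρ 𝔞₁ = 𝔞₂` and `ρ³ β₁ = β₂` for some `ρ ∈ k*`. -/
instance pairSetoid (k : Type*) [CommRing k] [Algebra ℚ k] (b c : ℕ) :
    Setoid (PairSet k b c) where
  r p q := ∃ ρ : kˣ, scale (ρ : k) p.1.1 = q.1.1 ∧ (ρ : k) ^ 3 * p.1.2 = q.1.2
  iseqv :=
    { refl := fun p => ⟨1, by simp [scale], by simp⟩
      symm := by
        rintro p q ⟨ρ, h1, h2⟩
        refine ⟨ρ⁻¹, ?_, ?_⟩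
        · rw [← h1, scale, scale, ← Submodule.map_comp, ← LinearMap.mulLeft_mul]
          simp
        · rw [← h2, ← mul_assoc, ← mul_pow]
          simp
      trans := by
        rintro p q r ⟨ρ, h1, h2⟩ ⟨σ, h3, h4⟩
        refine ⟨σ * ρ, ?_, ?_⟩
        · rw [← h3, ← h1, scale, scale, scale, ← Submodule.map_comp, ← LinearMap.mulLeft_mul]
          simp
        · rw [← h4, ← h2]
          push_cast
          ring }

/-- The index set of the union defining `S(n)`: the pairs of integers `b, c ≥ 1` with
`(b c)² Δ = n`. -/
abbrev BCIndex (n Δ : ℤ) : Type :=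
  {p : ℕ × ℕ // 1 ≤ p.1 ∧ 1 ≤ p.2 ∧ ((p.1 : ℤ) * (p.2 : ℤ)) ^ 2 * Δ = n}

/-- `S(n)`: the disjoint union of the sets `S_k(b,c)/∼` over `b, c ≥ 1` with `(b c)² Δ = n`,
where `Δ` is the discriminant of `k`. -/
abbrev PairClasses (k : Type*) [CommRing k] [Algebra ℚ k] (n Δ : ℤ) : Type _ :=
  Σ i : BCIndex n Δ, Quotient (pairSetoid k i.1.1 i.1.2)

/-! ### The map `Ψ_n` -/

section Map

variable {k : Type*} [CommRing k] [Algebra ℚ k]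

/-- `(α₁, α₂)` is a `ℤ`-basis of `𝔞` with
`N(β) (α₁ α₂^τ - α₂ α₁^τ) / √Δ < 0`. The quotient by `δ = √Δ` is the rational number `r`. -/
def IsAdmissibleBasis (τ : k ≃ₐ[ℚ] k) (δ : k) (a : Submodule ℤ k) (β α₁ α₂ : k) : Prop :=
  LinearIndependent ℤ ![α₁, α₂] ∧ Submodule.span ℤ {α₁, α₂} = a ∧
    ∃ r : ℚ, α₁ * τ α₂ - α₂ * τ α₁ = algebraMap ℚ k r * δ ∧ Algebra.norm ℚ β * r < 0

/-- `x(u,v) = Tr_{k/ℚ} ( β (α₁^τ u + α₂^τ v)³ / (c √Δ N𝔞³) )`, with `δ = √Δ`. The two sides are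
polynomials in `u, v`, compared through their values at all rational `u, v`. -/
def IsFormOf (τ : k ≃ₐ[ℚ] k) (δ : k) (c : ℕ) (a : Submodule ℤ k) (β α₁ α₂ : k)
    (x : CubicForm) : Prop :=
  ∀ u v : ℚ, x.eval u v =
    Algebra.trace ℚ k
      (β * Ring.inverse (algebraMap ℚ k ((c : ℚ) * idealNorm (quadOrderModule k c) a ^ 3) * δ) *
        (algebraMap ℚ k u * τ α₁ + algebraMap ℚ k v * τ α₂) ^ 3)

/-- `Ψ : S(n) → Γ \ L^∨(n)` is the map `Ψ_n`: every pair `(𝔞, β)` has an admissible basis, and for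
every admissible basis `(α₁, α₂)` the form `x(u,v)` above lies in `L^∨(n)` and its `Γ`-orbit is the
image under `Ψ` of the class of `(𝔞, β)`. These conditions determine `Ψ` uniquely. -/
def IsPsi (n Δ : ℤ) (τ : k ≃ₐ[ℚ] k) (δ : k) (Ψ : PairClasses k n Δ → DualOrbits n) : Prop :=
  ∀ (i : BCIndex n Δ) (p : PairSet k i.1.1 i.1.2),
    (∃ α₁ α₂ : k, IsAdmissibleBasis τ δ p.1.1 p.1.2 α₁ α₂) ∧
    ∀ α₁ α₂ : k, IsAdmissibleBasis τ δ p.1.1 p.1.2 α₁ α₂ →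
      ∃ x : dualForms n, IsFormOf τ δ i.1.2 p.1.1 p.1.2 α₁ α₂ x.1 ∧
        Ψ ⟨i, Quotient.mk _ p⟩ = Quotient.mk _ x

end Map

end OhnoNakagawa

/-!
# Binary cubic forms and ideal classes of quadratic orders

Write `O = O_{k,c}`, let `N` be the norm of an invertible `O`-ideal `𝔞` with basis `α₁, α₂`, and
let `x` be the form attached to `(𝔞, β)`. Quadratic fields and `ℚ × ℚ` are treated at once: by
`QuadraticFrame`, an element of `k = ℚ ⊕ ℚ δ` has coordinates `re`, `im`, and
`Tr(z / (c δ)) = 2 im z / c`. Three facts carry the proof.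

* *Ideals.* The norm form of `α₁, α₂` is `N` times a primitive integral form `(A, B, C)` of
  discriminant `c² Δ`, and `𝔞 𝔞^τ = N O` (`exists_isNormalized`, `IsNormalized.mul_conjModule`).
  Conversely such a pair spans an invertible ideal of norm `N`. Hence `𝔞⁻¹ = N⁻¹ 𝔞^τ`, and the norm
  of `β 𝔞⁻³` is `|N(β)| / N³` (`IsNormalized.idealNorm_scale`).
* *Integrality.* The order `O` is its own dual for the pairing `Tr(z w / (c δ))`. The coefficients
  of `x` are the values of `Tr(· / (c δ))` on the generators of `β 𝔞⁻³ = β N⁻³ (𝔞^τ)³`, up to the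
  binomial factors `3`; so they are integral exactly when `β ∈ 𝔞³`
  (`IsNormalized.mem_pow_three_iff`).
* *Hessian.* The Hessian of `x` is `N(β) / N³` times `(A, B, C)`, that is `± b` times a primitive
  form of discriminant `c² Δ` (`IsNormalized.hessian`). This gives `disc x = -27 (b c)² Δ = -27 n`, and
  shows that `x` determines `b` and `c`.

The Hessian and the sign condition on the basis determine the products `s α_i α_j^τ` with
`s = N(β) / N⁴`, hence the basis up to a common factor `ρ ∈ k*`, and then the coefficients of `x`
determine `β`: this is injectivity (`IsNormalized.exists_units_of_isFormOf`). For surjectivity one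
divides the Hessian of a given form by its content to obtain `(A, B, C)`, and takes
`𝔞 = ℤ A + ℤ (B + c δ) / 2` (`exists_pair_of_form`). Both arguments need `A ≠ 0`, so that `α₁` is a
unit of `k`, which is achieved by moving the form within its orbit (`exists_smul_hessian_ne_zero`).
-/

namespace OhnoNakagawa

theorem one_mem_quadOrderModule (k : Type*) [CommRing k] (c : ℕ) :
    (1 : k) ∈ quadOrderModule k c :=
  (quadOrder k c).one_mem

theorem quadOrderModule_mul_self (k : Type*) [CommRing k] (c : ℕ) :
    quadOrderModule k c * quadOrderModule k c = quadOrderModule k c :=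
  Subalgebra.isIdempotentElem_toSubmodule _

/-! ### Coordinates on a quadratic algebra -/

theorem trace_eq_two_mul_repr {k : Type*} [CommRing k] [Algebra ℚ k]
    (b : Module.Basis (Fin 2) ℚ k) (h0 : b 0 = 1) {d : ℚ}
    (h1 : b 1 ^ 2 = algebraMap ℚ k d) (z : k) : Algebra.trace ℚ k z = 2 * b.repr z 0 := by
  have hz : z = b.repr z 0 • b 0 + b.repr z 1 • b 1 := by
    conv_lhs => rw [← b.sum_repr z, Fin.sum_univ_two]
  have e : z * b 1 = b.repr z 0 • b 1 + (b.repr z 1 * d) • b 0 := by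
    conv_lhs => rw [hz]
    rw [h0, mul_smul, add_mul, smul_mul_assoc, smul_mul_assoc, one_mul, ← pow_two, h1,
      Algebra.algebraMap_eq_smul_one]
  rw [Algebra.trace_eq_matrix_trace b, Matrix.trace_fin_two, Algebra.leftMulMatrix_eq_repr_mul,
    Algebra.leftMulMatrix_eq_repr_mul, e, h0, mul_one, ← h0]
  simp [two_mul]

/-- Coordinates on a quadratic étale `ℚ`-algebra `k = ℚ ⊕ ℚ δ` with conjugation `τ` and
discriminant `Δ = δ²`. The field `mem_integralClosure` says that the maximal order is
`ℤ ⊕ ℤ (Δ + δ)/2`. Quadratic fields and `ℚ × ℚ` are both treated through this structure. -/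
structure QuadraticFrame (k : Type*) [CommRing k] [Algebra ℚ k] (τ : k ≃ₐ[ℚ] k) (δ : k)
    (Δ : ℤ) where
  basis : Module.Basis (Fin 2) ℚ k
  basis_zero : basis 0 = 1
  basis_one : basis 1 = δ
  sq : δ ^ 2 = (Δ : k)
  disc_ne_zero : Δ ≠ 0
  conj_delta : τ δ = -δ
  mem_integralClosure : ∀ z : k, z ∈ integralClosure ℤ k ↔
    ∃ m l : ℤ, basis.repr z 0 = m + l * (Δ / 2 : ℚ) ∧ basis.repr z 1 = l / 2

namespace QuadraticFrame

variable {k : Type*} [CommRing k] [Algebra ℚ k] {τ : k ≃ₐ[ℚ] k} {δ : k} {Δ : ℤ}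
  (S : QuadraticFrame k τ δ Δ)

/-- The coefficient of `1` of an element of `k = ℚ ⊕ ℚ δ`. -/
noncomputable def re (z : k) : ℚ := S.basis.repr z 0

/-- The coefficient of `δ` of an element of `k = ℚ ⊕ ℚ δ`. -/
noncomputable def im (z : k) : ℚ := S.basis.repr z 1

include S

theorem eq_re_add_im (z : k) : z = algebraMap ℚ k (S.re z) + algebraMap ℚ k (S.im z) * δ := by
  conv_lhs => rw [← S.basis.sum_repr z]
  rw [Fin.sum_univ_two, S.basis_zero, S.basis_one, Algebra.smul_def, Algebra.smul_def, mul_one]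
  rfl

theorem ext {z w : k} (h0 : S.re z = S.re w) (h1 : S.im z = S.im w) : z = w := by
  rw [S.eq_re_add_im z, S.eq_re_add_im w, h0, h1]

theorem re_add (z w : k) : S.re (z + w) = S.re z + S.re w := by simp [re]
theorem im_add (z w : k) : S.im (z + w) = S.im z + S.im w := by simp [im]
theorem re_sub (z w : k) : S.re (z - w) = S.re z - S.re w := by simp [re]
theorem im_sub (z w : k) : S.im (z - w) = S.im z - S.im w := by simp [im]
theorem re_zero : S.re 0 = 0 := by simp [re]
theorem im_zero : S.im 0 = 0 := by simp [im]

theorem re_algebraMap_mul (q : ℚ) (z : k) : S.re (algebraMap ℚ k q * z) = q * S.re z := by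
  rw [← Algebra.smul_def]; simp [re]

theorem im_algebraMap_mul (q : ℚ) (z : k) : S.im (algebraMap ℚ k q * z) = q * S.im z := by
  rw [← Algebra.smul_def]; simp [im]

theorem re_one : S.re 1 = 1 := by simp [re, ← S.basis_zero]
theorem im_one : S.im 1 = 0 := by simp [im, ← S.basis_zero]
theorem re_delta : S.re δ = 0 := by simp [re, ← S.basis_one]
theorem im_delta : S.im δ = 1 := by simp [im, ← S.basis_one]

theorem re_algebraMap (q : ℚ) : S.re (algebraMap ℚ k q) = q := by
  simpa [S.re_one] using S.re_algebraMap_mul q 1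

theorem im_algebraMap (q : ℚ) : S.im (algebraMap ℚ k q) = 0 := by
  simpa [S.im_one] using S.im_algebraMap_mul q 1

theorem re_intCast (m : ℤ) : S.re (m : k) = m := by
  simpa using S.re_algebraMap m

theorem im_intCast (m : ℤ) : S.im (m : k) = 0 := by
  simpa using S.im_algebraMap m

theorem re_natCast (m : ℕ) : S.re (m : k) = m := by
  simpa using S.re_algebraMap m

theorem im_natCast (m : ℕ) : S.im (m : k) = 0 := by
  simpa using S.im_algebraMap m

theorem mul_eq (z w : k) : z * w =
    algebraMap ℚ k (S.re z * S.re w + Δ * S.im z * S.im w) +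
      algebraMap ℚ k (S.re z * S.im w + S.im z * S.re w) * δ := by
  conv_lhs => rw [S.eq_re_add_im z, S.eq_re_add_im w]
  have h : algebraMap ℚ k (Δ : ℚ) = δ ^ 2 := by rw [S.sq]; simp
  simp only [map_add, map_mul, h]
  ring

theorem re_mul (z w : k) : S.re (z * w) = S.re z * S.re w + Δ * S.im z * S.im w := by
  rw [S.mul_eq, S.re_add, S.re_algebraMap, S.re_algebraMap_mul, S.re_delta]; ring

theorem im_mul (z w : k) : S.im (z * w) = S.re z * S.im w + S.im z * S.re w := by
  rw [S.mul_eq, S.im_add, S.im_algebraMap, S.im_algebraMap_mul, S.im_delta]; ring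

theorem conj_eq (z : k) : τ z = algebraMap ℚ k (S.re z) + algebraMap ℚ k (-S.im z) * δ := by
  conv_lhs => rw [S.eq_re_add_im z]
  rw [map_add, map_mul, S.conj_delta, AlgEquiv.commutes, AlgEquiv.commutes, map_neg]
  ring

theorem re_conj (z : k) : S.re (τ z) = S.re z := by
  rw [S.conj_eq, S.re_add, S.re_algebraMap, S.re_algebraMap_mul, S.re_delta]; ring

theorem im_conj (z : k) : S.im (τ z) = -S.im z := by
  rw [S.conj_eq, S.im_add, S.im_algebraMap, S.im_algebraMap_mul, S.im_delta]; ring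

theorem conj_conj (z : k) : τ (τ z) = z :=
  S.ext (by rw [S.re_conj, S.re_conj]) (by rw [S.im_conj, S.im_conj, neg_neg])

theorem trace_eq (z : k) : Algebra.trace ℚ k z = 2 * S.re z :=
  trace_eq_two_mul_repr S.basis S.basis_zero (d := Δ) (by rw [S.basis_one, S.sq]; simp) z

theorem norm_eq (z : k) : Algebra.norm ℚ z = S.re z ^ 2 - Δ * S.im z ^ 2 := by
  rw [Algebra.norm_eq_matrix_det S.basis, Matrix.det_fin_two]
  simp only [Algebra.leftMulMatrix_eq_repr_mul, S.basis_zero, S.basis_one]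
  change S.re (z * 1) * S.im (z * δ) - S.re (z * δ) * S.im (z * 1) = _
  rw [S.im_mul, mul_one, S.re_mul, S.re_delta, S.im_delta]; ring

theorem mul_conj_add (x y : k) :
    x * τ y + y * τ x = algebraMap ℚ k (2 * S.re (x * τ y)) := by
  apply S.ext
  · simp only [S.re_add, S.re_mul, S.re_conj, S.im_conj, S.re_algebraMap]; ring
  · simp only [S.im_add, S.im_mul, S.re_conj, S.im_conj, S.im_algebraMap]; ring

theorem mul_conj (z : k) : z * τ z = algebraMap ℚ k (Algebra.norm ℚ z) := by
  apply S.ext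
  · rw [S.re_mul, S.re_conj, S.im_conj, S.re_algebraMap, S.norm_eq]; ring
  · rw [S.im_mul, S.re_conj, S.im_conj, S.im_algebraMap]; ring

theorem finrank_eq : Module.finrank ℚ k = 2 := by
  rw [Module.finrank_eq_card_basis S.basis, Fintype.card_fin]

theorem isUnit_iff (z : k) : IsUnit z ↔ Algebra.norm ℚ z ≠ 0 := by
  constructor
  · intro h
    exact (h.map (Algebra.norm ℚ)).ne_zero
  · intro h
    refine IsUnit.of_mul_eq_one (algebraMap ℚ k (Algebra.norm ℚ z)⁻¹ * τ z) ?_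
    rw [mul_left_comm, S.mul_conj, ← map_mul, inv_mul_cancel₀ h, map_one]

theorem algebraMap_injective : Function.Injective (algebraMap ℚ k) := fun p q h => by
  simpa [S.re_algebraMap] using congrArg S.re h

/-! ### The order of conductor `c` -/

theorem mem_quadOrder_iff (c : ℕ) (z : k) : z ∈ quadOrderModule k c ↔
    ∃ m l : ℤ, S.re z = m + l * (c * Δ / 2 : ℚ) ∧ S.im z = l * (c / 2 : ℚ) := by
  change (∃ m : ℤ, ∃ y ∈ integralClosure ℤ k, z = (m : k) + (c : k) * y) ↔ _
  constructor
  · rintro ⟨m, y, hy, rfl⟩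
    obtain ⟨m', l, h0, h1⟩ := (S.mem_integralClosure y).1 hy
    change S.re y = _ at h0
    change S.im y = _ at h1
    refine ⟨m + c * m', l, ?_, ?_⟩
    · rw [S.re_add, S.re_mul, S.re_intCast, S.re_natCast, S.im_natCast, h0, h1]; push_cast; ring
    · rw [S.im_add, S.im_mul, S.im_intCast, S.re_natCast, S.im_natCast, h1]; ring
  · rintro ⟨m, l, h0, h1⟩
    refine ⟨m, algebraMap ℚ k (l * (Δ / 2 : ℚ)) + algebraMap ℚ k (l / 2 : ℚ) * δ, ?_, ?_⟩
    · refine (S.mem_integralClosure _).2 ⟨0, l, ?_, ?_⟩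
      · change S.re _ = _
        rw [S.re_add, S.re_algebraMap, S.re_algebraMap_mul, S.re_delta]; push_cast; ring
      · change S.im _ = _
        rw [S.im_add, S.im_algebraMap, S.im_algebraMap_mul, S.im_delta]; ring
    · apply S.ext
      · rw [h0, S.re_add, S.re_mul, S.re_intCast, S.re_natCast, S.im_natCast, S.re_add,
          S.re_algebraMap, S.re_algebraMap_mul, S.re_delta]; ring
      · rw [h1, S.im_add, S.im_mul, S.im_intCast, S.re_natCast, S.im_natCast, S.im_add,
          S.im_algebraMap, S.im_algebraMap_mul, S.im_delta]; ring

end QuadraticFrame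
/-! ### Multiples and conjugates of modules -/

section Scale

variable {k : Type*} [CommRing k]

theorem mem_scale {ρ z : k} {a : Submodule ℤ k} : z ∈ scale ρ a ↔ ∃ y ∈ a, ρ * y = z := by
  simp [scale, Submodule.mem_map]

theorem mul_mem_scale {z : k} {a : Submodule ℤ k} (ρ : k) (h : z ∈ a) : ρ * z ∈ scale ρ a :=
  mem_scale.2 ⟨z, h, rfl⟩

theorem scale_eq_span_mul (ρ : k) (a : Submodule ℤ k) : scale ρ a = Submodule.span ℤ {ρ} * a := by
  ext z
  rw [mem_scale, Submodule.mem_span_singleton_mul]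

theorem scale_scale (ρ σ : k) (a : Submodule ℤ k) : scale ρ (scale σ a) = scale (ρ * σ) a := by
  simp only [scale_eq_span_mul, ← mul_assoc, Submodule.span_mul_span, Set.singleton_mul_singleton]

theorem scale_one (a : Submodule ℤ k) : scale 1 a = a := by
  ext z; simp [mem_scale]

theorem scale_mul (ρ : k) (a b : Submodule ℤ k) : scale ρ (a * b) = scale ρ a * b := by
  simp only [scale_eq_span_mul, mul_assoc]

theorem mul_scale (ρ : k) (a b : Submodule ℤ k) : a * scale ρ b = scale ρ (a * b) := by
  simp only [scale_eq_span_mul]; exact mul_left_comm _ _ _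

theorem scale_mul_scale (ρ σ : k) (a b : Submodule ℤ k) :
    scale ρ a * scale σ b = scale (ρ * σ) (a * b) := by
  rw [mul_scale, ← scale_mul, scale_scale, mul_comm σ]

theorem scale_pow (ρ : k) (a : Submodule ℤ k) (n : ℕ) : scale ρ a ^ n = scale (ρ ^ n) (a ^ n) := by
  induction n with
  | zero => simp [scale_one]
  | succ n ih => rw [pow_succ, ih, scale_mul_scale, ← pow_succ, ← pow_succ]

theorem scale_neg (ρ : k) (a : Submodule ℤ k) : scale (-ρ) a = scale ρ a := by
  ext z
  rw [mem_scale, mem_scale]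
  constructor <;> rintro ⟨y, hy, rfl⟩ <;> exact ⟨-y, a.neg_mem hy, by ring⟩

theorem scale_span_pair (ρ x y : k) :
    scale ρ (Submodule.span ℤ {x, y}) = Submodule.span ℤ {ρ * x, ρ * y} := by
  rw [scale, Submodule.map_span, Set.image_pair]; rfl

theorem fg_scale {a : Submodule ℤ k} (ρ : k) (h : a.FG) : (scale ρ a).FG := h.map _

theorem mem_span_pair_left (x y : k) : x ∈ Submodule.span ℤ {x, y} :=
  Submodule.subset_span (by simp)

theorem mem_span_pair_right (x y : k) : y ∈ Submodule.span ℤ {x, y} :=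
  Submodule.subset_span (by simp)

theorem mem_span_pair_iff (x y z : k) :
    z ∈ Submodule.span ℤ {x, y} ↔ ∃ m l : ℤ, z = m * x + l * y := by
  rw [Submodule.mem_span_pair]
  simp only [zsmul_eq_mul, eq_comm]

theorem span_pair_le_iff {x y : k} {a : Submodule ℤ k} :
    Submodule.span ℤ {x, y} ≤ a ↔ x ∈ a ∧ y ∈ a := by
  rw [Submodule.span_le, Set.insert_subset_iff, Set.singleton_subset_iff]; rfl

variable [Algebra ℚ k]

/-- The conjugate `𝔞^τ` of a module. -/
def conjModule (τ : k ≃ₐ[ℚ] k) (a : Submodule ℤ k) : Submodule ℤ k :=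
  a.map (τ.toAlgHom.restrictScalars ℤ).toLinearMap

theorem mem_conjModule {τ : k ≃ₐ[ℚ] k} {a : Submodule ℤ k} {z : k} :
    z ∈ conjModule τ a ↔ ∃ y ∈ a, τ y = z := by
  simp [conjModule, Submodule.mem_map]

theorem conjModule_mul (τ : k ≃ₐ[ℚ] k) (a b : Submodule ℤ k) :
    conjModule τ (a * b) = conjModule τ a * conjModule τ b :=
  Submodule.map_mul _ _ _

theorem conjModule_pow (τ : k ≃ₐ[ℚ] k) (a : Submodule ℤ k) (n : ℕ) :
    conjModule τ (a ^ n) = conjModule τ a ^ n :=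
  Submodule.map_pow _ _ _

theorem conjModule_span_pair (τ : k ≃ₐ[ℚ] k) (x y : k) :
    conjModule τ (Submodule.span ℤ {x, y}) = Submodule.span ℤ {τ x, τ y} := by
  rw [conjModule, Submodule.map_span, Set.image_pair]; rfl

theorem conjModule_scale (τ : k ≃ₐ[ℚ] k) (ρ : k) (a : Submodule ℤ k) :
    conjModule τ (scale ρ a) = scale (τ ρ) (conjModule τ a) := by
  simp only [scale_eq_span_mul, conjModule_mul]
  congr 1
  rw [conjModule, Submodule.map_span, Set.image_singleton]; rfl

end Scale

namespace QuadraticFrame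

variable {k : Type*} [CommRing k] [Algebra ℚ k] {τ : k ≃ₐ[ℚ] k} {δ : k} {Δ : ℤ}
  (S : QuadraticFrame k τ δ Δ)

include S

theorem conjModule_conjModule (a : Submodule ℤ k) : conjModule τ (conjModule τ a) = a := by
  ext z
  simp only [mem_conjModule]
  constructor
  · rintro ⟨_, ⟨y, hy, rfl⟩, rfl⟩
    rwa [S.conj_conj]
  · intro hz
    exact ⟨τ z, ⟨z, hz, rfl⟩, S.conj_conj z⟩

theorem conjModule_quadOrder (c : ℕ) :
    conjModule τ (quadOrderModule k c) = quadOrderModule k c := by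
  have h : ∀ z ∈ quadOrderModule k c, τ z ∈ quadOrderModule k c := by
    intro z hz
    obtain ⟨m, l, h0, h1⟩ := (S.mem_quadOrder_iff c z).1 hz
    refine (S.mem_quadOrder_iff c _).2 ⟨m + l * (c * Δ), -l, ?_, ?_⟩
    · rw [S.re_conj, h0]; push_cast; ring
    · rw [S.im_conj, h1]; push_cast; ring
  ext z
  rw [mem_conjModule]
  constructor
  · rintro ⟨y, hy, rfl⟩
    exact h y hy
  · intro hz
    exact ⟨τ z, h z hz, S.conj_conj z⟩

/-! ### Determinants and indices of full modules -/

/-- The determinant of a pair of elements with respect to the basis `1, δ`. -/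
noncomputable def det (z w : k) : ℚ := S.re z * S.im w - S.im z * S.re w

theorem det_eq_basis_det (z w : k) : S.det z w = S.basis.det ![z, w] := by
  rw [Module.Basis.det_apply, Matrix.det_fin_two]
  simp [Module.Basis.toMatrix_apply, det, re, im]; ring

theorem sub_conj_eq (z w : k) : z * τ w - w * τ z = algebraMap ℚ k (-2 * S.det z w) * δ := by
  apply S.ext
  · simp only [S.re_sub, S.re_mul, S.re_conj, S.im_conj, S.re_algebraMap, S.im_algebraMap,
      S.re_delta, S.im_delta]; ring
  · simp only [S.im_sub, S.im_mul, S.re_conj, S.im_conj, S.re_algebraMap, S.im_algebraMap,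
      S.re_delta, S.im_delta, det]; ring

theorem det_comb (x y : k) (p q r s : ℤ) :
    S.det (p * x + q * y) (r * x + s * y) = (p * s - q * r) * S.det x y := by
  simp only [det, S.re_add, S.im_add, S.re_mul, S.im_mul, S.re_intCast, S.im_intCast]; ring

theorem det_mul (ρ x y : k) : S.det (ρ * x) (ρ * y) = Algebra.norm ℚ ρ * S.det x y := by
  simp only [det, S.norm_eq, S.re_mul, S.im_mul]; ring

/-- The discriminant of the norm form of a pair. -/
theorem disc_normForm (x y : k) : (2 * S.re (x * τ y)) ^ 2 -
    4 * Algebra.norm ℚ x * Algebra.norm ℚ y = 4 * Δ * S.det x y ^ 2 := by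
  simp only [det, S.norm_eq, S.re_mul, S.re_conj, S.im_conj]; ring

theorem linearIndependent_iff (x y : k) : LinearIndependent ℤ ![x, y] ↔ S.det x y ≠ 0 := by
  rw [LinearIndependent.iff_fractionRing ℤ ℚ, S.det_eq_basis_det, ← isUnit_iff_ne_zero,
    ← Module.Basis.is_basis_iff_det]
  refine ⟨fun h => ⟨h, ?_⟩, fun h => h.1⟩
  have := Module.Basis.finiteDimensional_of_finite S.basis
  exact h.span_eq_top_of_card_eq_finrank' (by rw [S.finrank_eq, Fintype.card_fin])

/-- The basis of `k` given by a pair with nonzero determinant. -/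
noncomputable def basisOfDet {x y : k} (h : S.det x y ≠ 0) : Module.Basis (Fin 2) ℚ k :=
  have h' := (Module.Basis.is_basis_iff_det S.basis (v := ![x, y])).2
    (by rw [← S.det_eq_basis_det]; exact h.isUnit)
  Module.Basis.mk h'.1 h'.2.ge

theorem coe_basisOfDet {x y : k} (h : S.det x y ≠ 0) : ⇑(S.basisOfDet h) = ![x, y] := by
  simp [basisOfDet]

theorem relIndex_span_pair {x y z w : k}
    (hle : Submodule.span ℤ {x, y} ≤ Submodule.span ℤ {z, w})
    (hxy : S.det x y ≠ 0) (hzw : S.det z w ≠ 0) :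
    ((Submodule.span ℤ {x, y}).toAddSubgroup.relIndex
      (Submodule.span ℤ {z, w}).toAddSubgroup : ℚ) = |S.det x y| / |S.det z w| := by
  have hcl : ∀ {x y : k} (h : S.det x y ≠ 0), (Submodule.span ℤ {x, y}).toAddSubgroup =
      AddSubgroup.closure (Set.range (S.basisOfDet h)) := by
    intro x y h
    rw [Submodule.span_int_eq_addSubgroupClosure, S.coe_basisOfDet]
    simp [Set.pair_comm]
  rw [AddSubgroup.relIndex_eq_abs_det _ _ hle (S.basisOfDet hxy) (S.basisOfDet hzw)
    (hcl hxy) (hcl hzw)]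
  have h := Module.Basis.det_mul_det S.basis (S.basisOfDet hzw) (S.basisOfDet hxy)
  rw [S.coe_basisOfDet hzw, S.coe_basisOfDet hxy, ← S.det_eq_basis_det, ← S.det_eq_basis_det] at h
  rw [S.coe_basisOfDet hxy, eq_div_iff (abs_ne_zero.2 hzw), ← abs_mul, mul_comm, h]

/-- The element `c (Δ + δ) / 2`, which generates `O_{k,c}` together with `1`. -/
noncomputable def gen (_ : QuadraticFrame k τ δ Δ) (c : ℕ) : k :=
  algebraMap ℚ k (c * Δ / 2) + algebraMap ℚ k (c / 2) * δ

theorem re_gen (c : ℕ) : S.re (S.gen c) = c * Δ / 2 := by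
  rw [gen, S.re_add, S.re_algebraMap, S.re_algebraMap_mul, S.re_delta]; ring

theorem im_gen (c : ℕ) : S.im (S.gen c) = c / 2 := by
  rw [gen, S.im_add, S.im_algebraMap, S.im_algebraMap_mul, S.im_delta]; ring

theorem quadOrder_eq_span (c : ℕ) : quadOrderModule k c = Submodule.span ℤ {1, S.gen c} := by
  ext z
  rw [S.mem_quadOrder_iff, mem_span_pair_iff]
  refine exists_congr fun m => exists_congr fun l => ⟨fun h => S.ext ?_ ?_, fun h => ?_⟩
  · rw [h.1]
    simp only [S.re_add, S.re_mul, S.re_intCast, S.im_intCast, S.re_gen, S.re_one]; ring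
  · rw [h.2]
    simp only [S.im_add, S.im_mul, S.re_intCast, S.im_intCast, S.im_gen, S.im_one]; ring
  · rw [h]
    simp only [S.re_add, S.re_mul, S.re_intCast, S.im_intCast, S.re_gen, S.re_one,
      S.im_add, S.im_mul, S.im_gen, S.im_one]
    constructor <;> ring

theorem det_one_gen (c : ℕ) : S.det 1 (S.gen c) = c / 2 := by
  rw [det, S.re_one, S.im_one, S.im_gen]; ring

theorem gen_mem (c : ℕ) : S.gen c ∈ quadOrderModule k c := by
  rw [S.quadOrder_eq_span]; exact mem_span_pair_right _ _

/-- The order `O_{k,c}` is its own dual for the pairing `(z, w) ↦ Tr(z w / (c δ))`; note that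
`Tr(z / (c δ)) = 2 im z / c`. -/
theorem mem_quadOrder_of_pairing {c : ℕ} {z : k} {l m : ℤ} (h0 : S.im z = l * (c / 2))
    (h1 : S.im (z * S.gen c) = m * (c / 2)) (hc : 1 ≤ c) : z ∈ quadOrderModule k c := by
  have hc0 : (c / 2 : ℚ) ≠ 0 := by positivity
  rw [S.im_mul, S.re_gen, S.im_gen, h0] at h1
  have h2 : S.re z = m - l * (c * Δ / 2) :=
    mul_right_cancel₀ hc0 (by linear_combination h1)
  refine (S.mem_quadOrder_iff c z).2 ⟨m - l * (c * Δ), l, ?_, h0⟩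
  rw [h2]; push_cast; ring

/-- Every element of `k` has a nonzero integral multiple in `O_{k,c}`. -/
theorem exists_natCast_mul_mem {c : ℕ} (hc : 1 ≤ c) (z : k) :
    ∃ N : ℕ, N ≠ 0 ∧ (N : k) * z ∈ quadOrderModule k c := by
  refine ⟨2 * c * ((S.re z).den * (S.im z).den), by positivity, ?_⟩
  have h0 := Rat.mul_den_eq_num (S.re z)
  have h1 := Rat.mul_den_eq_num (S.im z)
  refine (S.mem_quadOrder_iff c _).2 ⟨2 * c * ((S.re z).num * (S.im z).den)
    - 2 * (S.im z).num * (S.re z).den * (c * Δ), 4 * (S.im z).num * (S.re z).den, ?_, ?_⟩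
  · rw [S.re_mul, S.re_natCast, S.im_natCast]
    push_cast
    rw [← h0, ← h1]; ring
  · rw [S.im_mul, S.re_natCast, S.im_natCast]
    push_cast
    rw [← h1]; ring

/-- The norm of a full module with a given basis. -/
theorem idealNorm_span_pair {c : ℕ} (hc : 1 ≤ c) {x y : k} (h : S.det x y ≠ 0) :
    idealNorm (quadOrderModule k c) (Submodule.span ℤ {x, y}) = |S.det x y| / (c / 2) := by
  obtain ⟨N₁, hN₁, h₁⟩ := S.exists_natCast_mul_mem hc x
  obtain ⟨N₂, hN₂, h₂⟩ := S.exists_natCast_mul_mem hc y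
  set O := quadOrderModule k c with hO
  set a := Submodule.span ℤ {x, y} with ha
  -- the common submodule `N a` of `O` and `a` lets us compare both indices
  set N : ℕ := N₁ * N₂ with hN
  have hN0 : N ≠ 0 := mul_ne_zero hN₁ hN₂
  have hNO : Submodule.span ℤ {(N : k) * x, (N : k) * y} ≤ O := by
    refine span_pair_le_iff.2 ⟨?_, ?_⟩
    · have := O.smul_mem (N₂ : ℤ) h₁
      convert this using 1
      rw [zsmul_eq_mul, hN]; push_cast; ring
    · have := O.smul_mem (N₁ : ℤ) h₂
      convert this using 1
      rw [zsmul_eq_mul, hN]; push_cast; ring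
  have hNa : Submodule.span ℤ {(N : k) * x, (N : k) * y} ≤ a := by
    refine span_pair_le_iff.2 ⟨?_, ?_⟩
    · have := a.smul_mem (N : ℤ) (mem_span_pair_left x y)
      simpa using this
    · have := a.smul_mem (N : ℤ) (mem_span_pair_right x y)
      simpa using this
  have hdN : S.det ((N : k) * x) ((N : k) * y) = (N : ℚ) ^ 2 * S.det x y := by
    rw [S.det_mul, S.norm_eq, S.re_natCast, S.im_natCast]; ring
  have hdN0 : S.det ((N : k) * x) ((N : k) * y) ≠ 0 := by
    rw [hdN]; exact mul_ne_zero (by positivity) h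
  have hc0 : (0 : ℚ) < c / 2 := by positivity
  have hdO : S.det 1 (S.gen c) ≠ 0 := by rw [S.det_one_gen]; exact hc0.ne'
  have e1 := S.relIndex_span_pair (by rw [← S.quadOrder_eq_span]; exact hNO) hdN0 hdO
  rw [← S.quadOrder_eq_span, ← hO, S.det_one_gen, abs_of_pos hc0] at e1
  have e2 := S.relIndex_span_pair hNa hdN0 h
  rw [← ha] at e2
  set M := Submodule.span ℤ {(N : k) * x, (N : k) * y} with hM
  have f1 := AddSubgroup.relIndex_mul_relIndex M.toAddSubgroup
    (O.toAddSubgroup ⊓ a.toAddSubgroup) O.toAddSubgroup (le_inf hNO hNa) inf_le_left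
  have f2 := AddSubgroup.relIndex_mul_relIndex M.toAddSubgroup
    (O.toAddSubgroup ⊓ a.toAddSubgroup) a.toAddSubgroup (le_inf hNO hNa) inf_le_right
  rw [AddSubgroup.inf_relIndex_left] at f1
  rw [AddSubgroup.inf_relIndex_right] at f2
  have g1 : ((M.toAddSubgroup.relIndex O.toAddSubgroup : ℕ) : ℚ) ≠ 0 := by
    rw [e1]; exact div_ne_zero (abs_ne_zero.2 hdN0) hc0.ne'
  have g2 : ((M.toAddSubgroup.relIndex a.toAddSubgroup : ℕ) : ℚ) ≠ 0 := by
    rw [e2]; exact div_ne_zero (abs_ne_zero.2 hdN0) (abs_ne_zero.2 h)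
  have e : idealNorm O a = (M.toAddSubgroup.relIndex O.toAddSubgroup : ℚ) /
      (M.toAddSubgroup.relIndex a.toAddSubgroup : ℚ) := by
    rw [← f1] at g1
    rw [← f2] at g2
    push_cast at g1 g2
    rw [idealNorm, ← f1, ← f2]
    push_cast
    rw [mul_div_mul_left _ _ (left_ne_zero_of_mul g1)]
  rw [e, e1, e2]
  have h' := abs_ne_zero.2 h
  have h'' := abs_ne_zero.2 hdN0
  field_simp

/-- A finitely generated module is full as soon as it contains an independent pair. -/
theorem isFull_of_det_ne_zero {a : Submodule ℤ k} (hfg : a.FG) {x y : k} (hx : x ∈ a)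
    (hy : y ∈ a) (h : S.det x y ≠ 0) : IsFull a := by
  refine ⟨hfg, ?_⟩
  rw [S.finrank_eq]
  have hfin : Module.Finite ℤ a := Module.Finite.iff_fg.2 hfg
  have := Module.Basis.finiteDimensional_of_finite S.basis
  have htf : Module.IsTorsionFree ℤ k := Module.IsTorsionFree.trans_faithfulSMul ℤ ℚ k
  have b := Module.finBasis ℤ a
  apply le_antisymm
  · have hb : LinearIndependent ℤ (fun i => (b i : k)) :=
      b.linearIndependent.map' a.subtype (Submodule.ker_subtype a)
    rw [LinearIndependent.iff_fractionRing ℤ ℚ] at hb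
    simpa [S.finrank_eq] using hb.fintype_card_le_finrank
  · have hl := (S.linearIndependent_iff x y).2 h
    have : LinearIndependent ℤ ![(⟨x, hx⟩ : a), ⟨y, hy⟩] := by
      refine LinearIndependent.of_comp a.subtype ?_
      convert hl using 1
      ext i; fin_cases i <;> rfl
    simpa using this.fintype_card_le_finrank

/-- A full module has a `ℤ`-basis of two elements. -/
theorem exists_basis_of_isFull {a : Submodule ℤ k} (h : IsFull a) :
    ∃ x y : k, S.det x y ≠ 0 ∧ Submodule.span ℤ {x, y} = a := by
  obtain ⟨hfg, hr⟩ := h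
  rw [S.finrank_eq] at hr
  have hfin : Module.Finite ℤ a := Module.Finite.iff_fg.2 hfg
  have htf : Module.IsTorsionFree ℤ k := Module.IsTorsionFree.trans_faithfulSMul ℤ ℚ k
  have b := Module.finBasisOfFinrankEq ℤ a hr
  refine ⟨b 0, b 1, ?_, ?_⟩
  · rw [← S.linearIndependent_iff]
    have hb : LinearIndependent ℤ (fun i => (b i : k)) :=
      b.linearIndependent.map' a.subtype (Submodule.ker_subtype a)
    convert hb using 1
    ext i; fin_cases i <;> rfl
  · have := congrArg (Submodule.map a.subtype) b.span_eq
    rw [Submodule.map_span, Submodule.map_subtype_top] at this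
    refine Eq.trans ?_ this
    congr 1
    ext z
    simp [Fin.exists_fin_two, eq_comm]

end QuadraticFrame
/-! ### Norm forms of invertible ideals -/

/-- A triple of rational numbers that do not all vanish is a positive multiple of a primitive
integral triple. -/
theorem exists_primitive_triple (p q r : ℚ) (h : ¬ (p = 0 ∧ q = 0 ∧ r = 0)) :
    ∃ N : ℚ, 0 < N ∧ ∃ A B C : ℤ, p = N * A ∧ q = N * B ∧ r = N * C ∧
      ∃ u v w : ℤ, u * A + v * B + w * C = 1 := by
  obtain ⟨P, Q, R, M, hM, hp, hq, hr⟩ : ∃ P Q R : ℤ, ∃ M : ℚ, 0 < M ∧ p = M * P ∧ q = M * Q ∧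
      r = M * R := by
    refine ⟨p.num * q.den * r.den, q.num * p.den * r.den, r.num * p.den * q.den,
      ((p.den : ℚ) * q.den * r.den)⁻¹, by positivity, ?_, ?_, ?_⟩ <;>
    · have hp := Rat.mul_den_eq_num p
      have hq := Rat.mul_den_eq_num q
      have hr := Rat.mul_den_eq_num r
      push_cast
      simp only [← hp, ← hq, ← hr]
      have h1 : (p.den : ℚ) ≠ 0 := by positivity
      have h2 : (q.den : ℚ) ≠ 0 := by positivity
      have h3 : (r.den : ℚ) ≠ 0 := by positivity
      field_simp
  set g : ℤ := GCDMonoid.gcd P (GCDMonoid.gcd Q R) with hg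
  have hg0 : g ≠ 0 := by
    intro h0
    obtain ⟨rfl, h1⟩ := (gcd_eq_zero_iff P (GCDMonoid.gcd Q R)).1 h0
    obtain ⟨rfl, rfl⟩ := (gcd_eq_zero_iff Q R).1 h1
    exact h (by simp [hp, hq, hr])
  obtain ⟨A, hA⟩ : g ∣ P := gcd_dvd_left _ _
  obtain ⟨B, hB⟩ : g ∣ Q := (gcd_dvd_right _ _).trans (gcd_dvd_left _ _)
  obtain ⟨C, hC⟩ : g ∣ R := (gcd_dvd_right _ _).trans (gcd_dvd_right _ _)
  have hgpos : 0 < g := by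
    have := Int.nonneg_of_normalize_eq_self (normalize_gcd P (GCDMonoid.gcd Q R))
    exact lt_of_le_of_ne this hg0.symm
  obtain ⟨u, s, hus⟩ := exists_gcd_eq_mul_add_mul P (GCDMonoid.gcd Q R)
  obtain ⟨v, w, hvw⟩ := exists_gcd_eq_mul_add_mul Q R
  refine ⟨M * g, mul_pos hM (by exact_mod_cast hgpos), A, B, C, ?_, ?_, ?_, u, v * s, w * s, ?_⟩
  · rw [hp, hA]; push_cast; ring
  · rw [hq, hB]; push_cast; ring
  · rw [hr, hC]; push_cast; ring
  · apply mul_left_cancel₀ hg0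
    rw [← hg, hvw, hA, hB, hC] at hus
    linear_combination -hus

namespace QuadraticFrame

variable {k : Type*} [CommRing k] [Algebra ℚ k] {τ : k ≃ₐ[ℚ] k} {δ : k} {Δ : ℤ}
  (S : QuadraticFrame k τ δ Δ)

/-- The norm form of the pair `(x, y)` is `N` times the primitive integral form `(A, B, C)`, and the
module spanned by `x, y` has the determinant of an `O_{k,c}`-ideal of norm `N`. By
`IsNormalized.mul_conjModule` and `exists_isNormalized` this characterizes the bases of invertible
`O_{k,c}`-ideals of norm `N`. -/
structure IsNormalized (c : ℕ) (x y : k) (N : ℚ) (A B C : ℤ) : Prop where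
  pos : 0 < N
  norm_left : Algebra.norm ℚ x = N * A
  trace_mul : 2 * S.re (x * τ y) = N * B
  norm_right : Algebra.norm ℚ y = N * C
  primitive : ∃ u v w : ℤ, u * A + v * B + w * C = 1
  abs_det : |S.det x y| = c * N / 2

variable {S}

theorem im_mul_conj (x y : k) : S.im (x * τ y) = -S.det x y := by
  simp only [det, S.im_mul, S.re_conj, S.im_conj]; ring

namespace IsNormalized

variable {c : ℕ} {x y : k} {N : ℚ} {A B C : ℤ}

theorem det_ne_zero (hc : 1 ≤ c) (h : S.IsNormalized c x y N A B C) : S.det x y ≠ 0 := by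
  have := h.pos
  rw [← abs_ne_zero, h.abs_det]; positivity

theorem disc_eq (h : S.IsNormalized c x y N A B C) : B ^ 2 - 4 * A * C = c ^ 2 * Δ := by
  have h1 := S.disc_normForm x y
  have h2 : S.det x y ^ 2 = (c * N / 2) ^ 2 := by rw [← sq_abs, h.abs_det]
  rw [h.trace_mul, h.norm_left, h.norm_right, h2] at h1
  have hN : N ^ 2 ≠ 0 := pow_ne_zero _ h.pos.ne'
  have : ((B : ℚ) ^ 2 - 4 * A * C) = c ^ 2 * Δ := mul_left_cancel₀ hN (by linear_combination h1)
  exact_mod_cast this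

/-- The determinant is `c N / 2` up to a sign `e`. -/
theorem exists_sign (h : S.IsNormalized c x y N A B C) :
    ∃ e : ℤ, e ^ 2 = 1 ∧ S.det x y = -e * (c * N / 2) := by
  rcases abs_choice (S.det x y) with h1 | h1 <;> rw [h.abs_det] at h1
  · exact ⟨-1, by norm_num, by rw [← h1]; push_cast; ring⟩
  · exact ⟨1, by norm_num, by rw [h1]; push_cast; ring⟩

theorem re_quot (h : S.IsNormalized c x y N A B C) :
    S.re (algebraMap ℚ k N⁻¹ * (x * τ y)) = B / 2 := by
  have := h.pos.ne'
  have h1 : S.re (x * τ y) = N * B / 2 := by rw [← h.trace_mul]; ring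
  rw [S.re_algebraMap_mul, h1]; field_simp

theorem im_quot (h : S.IsNormalized c x y N A B C) {e : ℤ}
    (he : S.det x y = -e * (c * N / 2)) :
    S.im (algebraMap ℚ k N⁻¹ * (x * τ y)) = e * (c / 2) := by
  have := h.pos.ne'
  rw [S.im_algebraMap_mul, im_mul_conj, he]; field_simp

theorem quot_mem (h : S.IsNormalized c x y N A B C) :
    algebraMap ℚ k N⁻¹ * (x * τ y) ∈ quadOrderModule k c := by
  obtain ⟨e, he, hd⟩ := h.exists_sign
  have hD := h.disc_eq
  have h2 : (2 : ℤ) ∣ B - e * (c * Δ) := by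
    have he' : e = 1 ∨ e = -1 := mul_self_eq_one_iff.1 ((pow_two e).symm.trans he)
    have h4 : Even (B - e * (c * Δ)) := by
      have h5 : Even (B ^ 2 - (c * c) * Δ) := ⟨2 * A * C, by linear_combination hD⟩
      rcases he' with rfl | rfl <;> revert h5 <;> simp [Int.even_sub, Int.even_mul, parity_simps]
    exact h4.two_dvd
  obtain ⟨m, hm⟩ := h2
  have hm' : (B : ℚ) = e * (c * Δ) + 2 * m := by
    have : B = e * (c * Δ) + 2 * m := by linear_combination hm
    exact_mod_cast this
  refine (S.mem_quadOrder_iff c _).2 ⟨m, e, ?_, h.im_quot hd⟩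
  rw [h.re_quot, hm']; ring

theorem conj_quot_mem (h : S.IsNormalized c x y N A B C) :
    algebraMap ℚ k N⁻¹ * (y * τ x) ∈ quadOrderModule k c := by
  rw [← S.conjModule_quadOrder, mem_conjModule]
  exact ⟨_, h.quot_mem, by rw [map_mul, map_mul, AlgEquiv.commutes, S.conj_conj, mul_comm (τ x)]⟩

/-- The order is spanned by `1` and `x y^τ / N`. -/
theorem exists_eq_of_mem (hc : 1 ≤ c) (h : S.IsNormalized c x y N A B C) {z : k}
    (hz : z ∈ quadOrderModule k c) :
    ∃ m l : ℤ, z = m + l * (algebraMap ℚ k N⁻¹ * (x * τ y)) := by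
  obtain ⟨e, he, hd⟩ := h.exists_sign
  obtain ⟨m, l, h0, h1⟩ := (S.mem_quadOrder_iff c z).1 hz
  obtain ⟨m', l', h0', h1'⟩ := (S.mem_quadOrder_iff c _).1 h.quot_mem
  have heq : (e : ℚ) ^ 2 = 1 := by exact_mod_cast he
  have hl : (l' : ℚ) = e := by
    have hc0 : (c / 2 : ℚ) ≠ 0 := by positivity
    exact mul_right_cancel₀ hc0 (by rw [← h1', h.im_quot hd])
  refine ⟨m - l * e * m', l * e, S.ext ?_ ?_⟩
  · rw [S.re_add, S.re_mul, S.re_intCast, S.re_intCast, S.im_intCast, h0, h0', hl]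
    push_cast
    linear_combination (-(l : ℚ) * (c * Δ / 2)) * heq
  · rw [S.im_add, S.im_mul, S.re_intCast, S.im_intCast, S.im_intCast, h1, h.im_quot hd]
    push_cast
    linear_combination (-(l : ℚ) * (c / 2)) * heq

theorem norm_left_eq (h : S.IsNormalized c x y N A B C) :
    x * τ x = algebraMap ℚ k N * A := by
  rw [S.mul_conj, h.norm_left, map_mul]; simp

theorem norm_right_eq (h : S.IsNormalized c x y N A B C) :
    y * τ y = algebraMap ℚ k N * C := by
  rw [S.mul_conj, h.norm_right, map_mul]; simp

theorem trace_eq (h : S.IsNormalized c x y N A B C) :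
    x * τ y + y * τ x = algebraMap ℚ k N * B := by
  rw [S.mul_conj_add, h.trace_mul, map_mul]; simp

end IsNormalized

/-- Multiplication by `x y^τ / N` maps the module spanned by `x, y` to itself, provided that the
norm form of the pair is `N (A, B, C)`. -/
theorem quot_mul_mem {x y : k} {N : ℚ} (hN : N ≠ 0) {A B C : ℤ}
    (hA : x * τ x = algebraMap ℚ k N * A) (hB : x * τ y + y * τ x = algebraMap ℚ k N * B)
    (hC : y * τ y = algebraMap ℚ k N * C) {z : k} (hz : z ∈ Submodule.span ℤ {x, y}) :
    algebraMap ℚ k N⁻¹ * (x * τ y) * z ∈ Submodule.span ℤ {x, y} := by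
  have hNN : algebraMap ℚ k N⁻¹ * algebraMap ℚ k N = 1 := by
    rw [← map_mul, inv_mul_cancel₀ hN, map_one]
  obtain ⟨m, l, rfl⟩ := (mem_span_pair_iff x y z).1 hz
  refine (mem_span_pair_iff x y _).2 ⟨m * B + l * C, -m * A, ?_⟩
  push_cast
  linear_combination (algebraMap ℚ k N⁻¹ * m * x) * hB - (algebraMap ℚ k N⁻¹ * m * y) * hA +
    (algebraMap ℚ k N⁻¹ * l * x) * hC + (m * x * B - m * y * A + l * C * x) * hNN

theorem IsNormalized.order_mul {c : ℕ} (hc : 1 ≤ c) {x y : k} {N : ℚ} {A B C : ℤ}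
    (h : S.IsNormalized c x y N A B C) :
    quadOrderModule k c * Submodule.span ℤ {x, y} = Submodule.span ℤ {x, y} := by
  apply le_antisymm
  · rw [Submodule.mul_le]
    intro w hw z hz
    obtain ⟨m, l, rfl⟩ := h.exists_eq_of_mem hc hw
    rw [add_mul]
    refine add_mem ?_ ?_
    · rw [← zsmul_eq_mul]
      exact Submodule.smul_mem _ _ hz
    · rw [mul_assoc, ← zsmul_eq_mul]
      exact Submodule.smul_mem _ _
        (quot_mul_mem h.pos.ne' h.norm_left_eq h.trace_eq h.norm_right_eq hz)
  · intro z hz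
    simpa using Submodule.mul_mem_mul (one_mem_quadOrderModule k c) hz

theorem norm_mem_mul_conj {x y : k} {N : ℚ} {A B C : ℤ}
    (hA : x * τ x = algebraMap ℚ k N * A) (hB : x * τ y + y * τ x = algebraMap ℚ k N * B)
    (hC : y * τ y = algebraMap ℚ k N * C)
    (hp : ∃ u v w : ℤ, u * A + v * B + w * C = 1) :
    algebraMap ℚ k N ∈ Submodule.span ℤ {x, y} * conjModule τ (Submodule.span ℤ {x, y}) := by
  obtain ⟨u, v, w, huvw⟩ := hp
  rw [conjModule_span_pair]
  have hx := mem_span_pair_left x y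
  have hy := mem_span_pair_right x y
  have hx' := mem_span_pair_left (τ x) (τ y)
  have hy' := mem_span_pair_right (τ x) (τ y)
  have e : algebraMap ℚ k N = u • (x * τ x) + v • (x * τ y + y * τ x) + w • (y * τ y) := by
    rw [hA, hB, hC]
    simp only [zsmul_eq_mul]
    have : ((u * A + v * B + w * C : ℤ) : k) = 1 := by rw [huvw]; simp
    push_cast at this
    linear_combination (-algebraMap ℚ k N) * this
  rw [e]
  exact add_mem (add_mem (Submodule.smul_mem _ _ (Submodule.mul_mem_mul hx hx'))
    (Submodule.smul_mem _ _ (add_mem (Submodule.mul_mem_mul hx hy')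
      (Submodule.mul_mem_mul hy hx')))) (Submodule.smul_mem _ _ (Submodule.mul_mem_mul hy hy'))

/-- `𝔞 𝔞^τ = N 𝔞 O_{k,c}`. -/
theorem IsNormalized.mul_conjModule {c : ℕ} (hc : 1 ≤ c) {x y : k} {N : ℚ} {A B C : ℤ}
    (h : S.IsNormalized c x y N A B C) :
    Submodule.span ℤ {x, y} * conjModule τ (Submodule.span ℤ {x, y}) =
      scale (algebraMap ℚ k N) (quadOrderModule k c) := by
  have hNN : algebraMap ℚ k N * algebraMap ℚ k N⁻¹ = 1 := by
    rw [← map_mul, mul_inv_cancel₀ h.pos.ne', map_one]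
  apply le_antisymm
  · rw [conjModule_span_pair, Submodule.span_mul_span, Submodule.span_le]
    rintro _ ⟨p, hp, q, hq, rfl⟩
    have hint : ∀ m : ℤ, (m : k) ∈ quadOrderModule k c := fun m => by
      simpa using Submodule.smul_mem _ m (one_mem_quadOrderModule k c)
    rcases hp with rfl | rfl <;> rcases hq with rfl | rfl <;> dsimp only
    · exact mem_scale.2 ⟨A, hint A, h.norm_left_eq.symm⟩
    · exact mem_scale.2 ⟨_, h.quot_mem, by linear_combination (p * τ y) * hNN⟩
    · exact mem_scale.2 ⟨_, h.conj_quot_mem, by linear_combination (p * τ x) * hNN⟩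
    · exact mem_scale.2 ⟨C, hint C, h.norm_right_eq.symm⟩
  · have h1 := norm_mem_mul_conj h.norm_left_eq h.trace_eq h.norm_right_eq h.primitive
    intro z hz
    obtain ⟨w, hw, rfl⟩ := mem_scale.1 hz
    rw [← h.order_mul hc, mul_assoc, mul_comm (algebraMap ℚ k N)]
    refine Submodule.mul_mem_mul hw ?_
    rwa [h.order_mul hc]

variable (S)

/-- Every basis of an invertible `O_{k,c}`-ideal is normalized. The norm form is `N (A, B, C)` with
`(A, B, C)` primitive; `x y^τ / N` multiplies the ideal to itself, hence lies in `O_{k,c}`, and it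
generates `O_{k,c}` over `ℤ` because `𝔞 𝔞^τ` is an `O_{k,c}`-module containing `N`. -/
theorem exists_isNormalized {c : ℕ} (hc : 1 ≤ c) {x y : k} (hdet : S.det x y ≠ 0)
    (hO : quadOrderModule k c * Submodule.span ℤ {x, y} = Submodule.span ℤ {x, y})
    {b : Submodule ℤ k} (hb : Submodule.span ℤ {x, y} * b = quadOrderModule k c) :
    ∃ (N : ℚ) (A B C : ℤ), S.IsNormalized c x y N A B C := by
  have hdisc := S.disc_normForm x y
  obtain ⟨N, hN, A, B, C, hA, hB, hC, hprim⟩ := exists_primitive_triple (Algebra.norm ℚ x)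
    (2 * S.re (x * τ y)) (Algebra.norm ℚ y) (by
      rintro ⟨h1, h2, h3⟩
      rw [h1, h2, h3] at hdisc
      have hΔ : (Δ : ℚ) ≠ 0 := by exact_mod_cast S.disc_ne_zero
      have : 4 * (Δ : ℚ) * S.det x y ^ 2 ≠ 0 := by positivity
      exact this (by rw [← hdisc]; ring))
  have hA' : x * τ x = algebraMap ℚ k N * A := by rw [S.mul_conj, hA, map_mul]; simp
  have hC' : y * τ y = algebraMap ℚ k N * C := by rw [S.mul_conj, hC, map_mul]; simp
  have hB' : x * τ y + y * τ x = algebraMap ℚ k N * B := by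
    rw [S.mul_conj_add, hB, map_mul]; simp
  set a := Submodule.span ℤ {x, y} with ha
  set P := algebraMap ℚ k N⁻¹ * (x * τ y) with hP
  -- `P` stabilizes `a`, hence lies in the order since `a b = O`
  have hPO : P ∈ quadOrderModule k c := by
    have h1 : Submodule.span ℤ {P} * a ≤ a := by
      rw [Submodule.mul_le]
      intro p hp z hz
      obtain ⟨m, rfl⟩ := Submodule.mem_span_singleton.1 hp
      rw [smul_mul_assoc]
      exact Submodule.smul_mem _ _ (quot_mul_mem hN.ne' hA' hB' hC' hz)
    have h2 : Submodule.span ℤ {P} * quadOrderModule k c ≤ quadOrderModule k c := by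
      rw [← hb, ← mul_assoc]
      exact mul_le_mul' h1 le_rfl
    simpa using h2 (Submodule.mul_mem_mul (Submodule.mem_span_singleton_self P)
      (one_mem_quadOrderModule k c))
  obtain ⟨m, l, -, hl⟩ := (S.mem_quadOrder_iff c P).1 hPO
  have hdl : S.det x y = -l * (c * N / 2) := by
    rw [hP, S.im_algebraMap_mul, im_mul_conj] at hl
    field_simp at hl
    linear_combination (-1 / 2 : ℚ) * hl
  have hmem : algebraMap ℚ k N * S.gen c ∈ a * conjModule τ a := by
    have h1 := Submodule.mul_mem_mul (S.gen_mem c) (norm_mem_mul_conj hA' hB' hC' hprim)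
    rwa [← ha, ← mul_assoc, hO, mul_comm (S.gen c)] at h1
  have him : ∀ z ∈ a * conjModule τ a, ∃ j : ℤ, S.im z = j * S.det x y := by
    intro z hz
    induction hz using Submodule.mul_induction_on' with
    | mem_mul_mem p hp q hq =>
      obtain ⟨q, hq', rfl⟩ := mem_conjModule.1 hq
      obtain ⟨m, l, rfl⟩ := (mem_span_pair_iff x y p).1 hp
      obtain ⟨m', l', rfl⟩ := (mem_span_pair_iff x y q).1 hq'
      refine ⟨-(m * l' - l * m'), ?_⟩
      rw [im_mul_conj, S.det_comb]; push_cast; ring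
    | add p hp q hq h1 h2 =>
      obtain ⟨i, hi⟩ := h1
      obtain ⟨j, hj⟩ := h2
      exact ⟨i + j, by rw [S.im_add, hi, hj]; push_cast; ring⟩
  obtain ⟨j, hj⟩ := him _ hmem
  rw [S.im_algebraMap_mul, S.im_gen, hdl] at hj
  have hcN : (c * N / 2 : ℚ) ≠ 0 := by positivity
  have hjl : j * -l = 1 := by
    have : ((j : ℚ) * -l) = 1 := mul_right_cancel₀ hcN (by linear_combination -hj)
    exact_mod_cast this
  have hl1 : |(-l : ℚ)| = 1 := by
    have : IsUnit (-l) := IsUnit.of_mul_eq_one j (by linear_combination hjl)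
    have := Int.isUnit_iff_abs_eq.1 this
    exact_mod_cast this
  refine ⟨N, A, B, C, hN, hA, hB, hC, hprim, ?_⟩
  rw [hdl, abs_mul, hl1, one_mul, abs_of_pos (by positivity)]

variable {S}

theorem IsNormalized.idealNorm_eq {c : ℕ} (hc : 1 ≤ c) {x y : k} {N : ℚ} {A B C : ℤ}
    (h : S.IsNormalized c x y N A B C) :
    idealNorm (quadOrderModule k c) (Submodule.span ℤ {x, y}) = N := by
  rw [S.idealNorm_span_pair hc (h.det_ne_zero hc), h.abs_det]
  have : (c : ℚ) ≠ 0 := by positivity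
  field_simp

variable (S)

include S in
theorem scale_quadOrder_inj {c : ℕ} {p q : ℚ} (hp : 0 < p) (hq : 0 < q)
    (h : scale (algebraMap ℚ k p) (quadOrderModule k c) =
      scale (algebraMap ℚ k q) (quadOrderModule k c)) : p = q := by
  have key : ∀ {p q : ℚ}, 0 < p → 0 < q → scale (algebraMap ℚ k p) (quadOrderModule k c) =
      scale (algebraMap ℚ k q) (quadOrderModule k c) → q ≤ p := by
    intro p q hp hq h
    have h1 := mul_mem_scale (algebraMap ℚ k p) (one_mem_quadOrderModule k c)
    rw [h] at h1
    obtain ⟨z, hz, hzp⟩ := mem_scale.1 h1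
    obtain ⟨m, l, h0, h1⟩ := (S.mem_quadOrder_iff c z).1 hz
    have e1 := congrArg S.im hzp
    rw [S.im_algebraMap_mul, mul_one, S.im_algebraMap] at e1
    have e0 := congrArg S.re hzp
    rw [S.re_algebraMap_mul, mul_one, S.re_algebraMap] at e0
    have hz0 : S.im z = 0 := (mul_eq_zero.1 e1).resolve_left hq.ne'
    have hm : S.re z = m := by rw [h0]; linear_combination (-(Δ : ℚ)) * h1 + (Δ : ℚ) * hz0
    rw [hm] at e0
    have hm0 : (0 : ℚ) < m := by
      by_contra hcon
      push Not at hcon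
      exact absurd (mul_nonpos_of_nonneg_of_nonpos hq.le hcon) (by rw [e0]; exact hp.not_ge)
    have hm1 : (1 : ℚ) ≤ m := by
      have : (0 : ℤ) < m := by exact_mod_cast hm0
      exact_mod_cast this
    rw [← e0]
    exact le_mul_of_one_le_right hq.le hm1
  exact le_antisymm (key hq hp h.symm) (key hp hq h)

end QuadraticFrame
/-! ### The conditions on a pair in terms of a basis -/

theorem span_pair_pow_three_le_iff {k : Type*} [CommRing k] {p q : k} {T : Submodule ℤ k} :
    Submodule.span ℤ {p, q} ^ 3 ≤ T ↔
      p ^ 3 ∈ T ∧ p ^ 2 * q ∈ T ∧ p * q ^ 2 ∈ T ∧ q ^ 3 ∈ T := by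
  rw [pow_three, Submodule.span_mul_span, Submodule.span_mul_span, Submodule.span_le]
  constructor
  · intro h
    have key : ∀ r ∈ ({p, q} : Set k), ∀ s ∈ ({p, q} : Set k), ∀ t ∈ ({p, q} : Set k),
        r * (s * t) ∈ T := fun r hr s hs t ht => h (Set.mul_mem_mul hr (Set.mul_mem_mul hs ht))
    have hp : p ∈ ({p, q} : Set k) := by simp
    have hq : q ∈ ({p, q} : Set k) := by simp
    refine ⟨?_, ?_, ?_, ?_⟩
    · convert key p hp p hp p hp using 1; ring
    · convert key p hp p hp q hq using 1; ring
    · convert key p hp q hq q hq using 1; ring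
    · convert key q hq q hq q hq using 1; ring
  · rintro ⟨h3, h2, h1, h0⟩ _ ⟨r, hr, _, ⟨s, hs, t, ht, rfl⟩, rfl⟩
    have e0 : p * (p * p) = p ^ 3 := by ring
    have e1 : p * (p * q) = p ^ 2 * q := by ring
    have e2 : p * (q * p) = p ^ 2 * q := by ring
    have e3 : p * (q * q) = p * q ^ 2 := by ring
    have e4 : q * (p * p) = p ^ 2 * q := by ring
    have e5 : q * (p * q) = p * q ^ 2 := by ring
    have e6 : q * (q * p) = p * q ^ 2 := by ring
    have e7 : q * (q * q) = q ^ 3 := by ring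
    rcases hr with rfl | rfl <;> rcases hs with rfl | rfl <;> rcases ht with rfl | rfl <;>
      simp only [SetLike.mem_coe, e0, e1, e2, e3, e4, e5, e6, e7] <;> assumption

theorem order_mul_pow_three {k : Type*} [CommRing k] {c : ℕ} {a : Submodule ℤ k}
    (ha : quadOrderModule k c * a = a) :
    quadOrderModule k c * a ^ 3 = a ^ 3 := by
  rw [pow_succ', ← mul_assoc, ha]

theorem isUnit_of_idealNorm_ne_zero {k : Type*} [CommRing k] [Algebra ℚ k] {c : ℕ}
    {β : k} {J : Submodule ℤ k}
    (h : idealNorm (quadOrderModule k c) (scale β J) ≠ 0) : IsUnit β := by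
  have h1 : (scale β J).toAddSubgroup.relIndex (quadOrderModule k c).toAddSubgroup ≠ 0 := by
    intro h0
    exact h (by rw [idealNorm, h0]; simp)
  obtain ⟨n, hn, -, hmem, -⟩ := AddSubgroup.exists_nsmul_mem_of_relIndex_ne_zero h1
    (one_mem_quadOrderModule k c : (1 : k) ∈ (quadOrderModule k c).toAddSubgroup)
  obtain ⟨z, -, hz⟩ := mem_scale.1 (show n • (1 : k) ∈ scale β J from hmem)
  have hu : IsUnit (β * z) := by
    rw [hz, nsmul_eq_mul, mul_one]
    have : IsUnit (algebraMap ℚ k n) :=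
      (isUnit_iff_ne_zero.2 (by exact_mod_cast hn.ne' : (n : ℚ) ≠ 0)).map _
    simpa using this
  exact isUnit_of_mul_isUnit_left hu

namespace QuadraticFrame

variable {k : Type*} [CommRing k] [Algebra ℚ k] {τ : k ≃ₐ[ℚ] k} {δ : k} {Δ : ℤ}
  (S : QuadraticFrame k τ δ Δ)

include S

theorem isUnit_delta : IsUnit δ := by
  rw [S.isUnit_iff, S.norm_eq, S.re_delta, S.im_delta]
  have : (Δ : ℚ) ≠ 0 := by exact_mod_cast S.disc_ne_zero
  simpa using this

/-- A full `O_{k,c}`-module contains a unit of `k`, namely a rational multiple of `δ`. -/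
theorem exists_isUnit_mem {c : ℕ} (hc : 1 ≤ c) {x y : k} (h : S.det x y ≠ 0)
    (hO : quadOrderModule k c * Submodule.span ℤ {x, y} = Submodule.span ℤ {x, y}) :
    ∃ u ∈ Submodule.span ℤ {x, y}, IsUnit u := by
  obtain ⟨M, hM, hMx⟩ := S.exists_natCast_mul_mem hc (τ x)
  obtain ⟨N, hN, hNy⟩ := S.exists_natCast_mul_mem hc (τ y)
  refine ⟨algebraMap ℚ k (M * N * (-2 * S.det x y)) * δ, ?_, ?_⟩
  · have h1 := Submodule.mul_mem_mul hNy (mem_span_pair_left x y)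
    have h2 := Submodule.mul_mem_mul hMx (mem_span_pair_right x y)
    rw [hO] at h1 h2
    have h3 := sub_mem (Submodule.smul_mem _ (M : ℤ) h1) (Submodule.smul_mem _ (N : ℤ) h2)
    convert h3 using 1
    rw [map_mul, mul_assoc, ← S.sub_conj_eq, zsmul_eq_mul, zsmul_eq_mul, map_mul]
    simp only [map_natCast, Int.cast_natCast]
    ring
  · refine IsUnit.mul ?_ S.isUnit_delta
    refine IsUnit.map _ (isUnit_iff_ne_zero.2 ?_)
    have h1 : (M : ℚ) ≠ 0 := by exact_mod_cast hM
    have h2 : (N : ℚ) ≠ 0 := by exact_mod_cast hN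
    exact mul_ne_zero (mul_ne_zero h1 h2) (mul_ne_zero (by norm_num) h)

variable {S}

section Normalized

variable {c : ℕ} {x y : k} {N : ℚ} {A B C : ℤ}

theorem IsNormalized.conj_order_mul (hc : 1 ≤ c) (h : S.IsNormalized c x y N A B C) :
    quadOrderModule k c * conjModule τ (Submodule.span ℤ {x, y}) =
      conjModule τ (Submodule.span ℤ {x, y}) := by
  have := congrArg (conjModule τ) (h.order_mul hc)
  rwa [conjModule_mul, S.conjModule_quadOrder] at this

theorem IsNormalized.isFracIdeal (hc : 1 ≤ c) (h : S.IsNormalized c x y N A B C) :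
    IsFracIdeal (quadOrderModule k c) (Submodule.span ℤ {x, y}) :=
  ⟨S.isFull_of_det_ne_zero (Submodule.fg_span (by simp)) (mem_span_pair_left x y)
    (mem_span_pair_right x y) (h.det_ne_zero hc), h.order_mul hc⟩

theorem IsNormalized.isFracIdeal_inv (hc : 1 ≤ c) (h : S.IsNormalized c x y N A B C) :
    IsFracIdeal (quadOrderModule k c)
      (scale (algebraMap ℚ k N⁻¹) (conjModule τ (Submodule.span ℤ {x, y}))) := by
  refine ⟨?_, by rw [mul_scale, h.conj_order_mul hc]⟩
  rw [conjModule_span_pair, scale_span_pair]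
  refine S.isFull_of_det_ne_zero (Submodule.fg_span (by simp)) (mem_span_pair_left _ _)
    (mem_span_pair_right _ _) ?_
  have hd : S.det (τ x) (τ y) = -S.det x y := by
    simp only [det, S.re_conj, S.im_conj]; ring
  rw [S.det_mul, hd, S.norm_eq, S.re_algebraMap, S.im_algebraMap]
  have h1 := h.pos.ne'
  have h2 := h.det_ne_zero hc
  simp [h1, h2]

theorem IsNormalized.mul_inv (hc : 1 ≤ c) (h : S.IsNormalized c x y N A B C) :
    Submodule.span ℤ {x, y} *
      scale (algebraMap ℚ k N⁻¹) (conjModule τ (Submodule.span ℤ {x, y})) =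
        quadOrderModule k c := by
  rw [mul_scale, h.mul_conjModule hc, scale_scale, ← map_mul, inv_mul_cancel₀ h.pos.ne', map_one,
    scale_one]

theorem IsNormalized.invIdeal_eq (hc : 1 ≤ c) (h : S.IsNormalized c x y N A B C) :
    invIdeal (quadOrderModule k c) (Submodule.span ℤ {x, y}) =
      scale (algebraMap ℚ k N⁻¹) (conjModule τ (Submodule.span ℤ {x, y})) :=
  invIdeal_eq_of_mul_eq (one_mem_quadOrderModule k c) (h.isFracIdeal_inv hc) (h.mul_inv hc)

theorem IsNormalized.pow_three_mul (hc : 1 ≤ c) (h : S.IsNormalized c x y N A B C) :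
    Submodule.span ℤ {x, y} ^ 3 * conjModule τ (Submodule.span ℤ {x, y}) ^ 3 =
      scale (algebraMap ℚ k (N ^ 3)) (quadOrderModule k c) := by
  rw [← mul_pow, h.mul_conjModule hc, scale_pow, map_pow]
  congr 1
  rw [pow_three, quadOrderModule_mul_self, quadOrderModule_mul_self]

/-- `N(β 𝔞⁻³) = |N(β)| / N(𝔞)³` for a unit `β` of `k`. -/
theorem IsNormalized.idealNorm_scale (hc : 1 ≤ c) (h : S.IsNormalized c x y N A B C) {β : k}
    (hβ : IsUnit β) : idealNorm (quadOrderModule k c)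
      (scale β (invIdeal (quadOrderModule k c) (Submodule.span ℤ {x, y}) ^ 3)) =
        |Algebra.norm ℚ β| / N ^ 3 := by
  have hJ := h.isFracIdeal_inv hc
  have hJa := h.mul_inv hc
  rw [h.invIdeal_eq hc]
  set J := scale (algebraMap ℚ k N⁻¹) (conjModule τ (Submodule.span ℤ {x, y})) with hJdef
  set M := scale β (J ^ 3) with hM
  have hOM : quadOrderModule k c * M = M := by
    rw [hM, mul_scale, order_mul_pow_three hJ.2]
  have hNβ := (S.isUnit_iff β).1 hβ
  have hMfull : IsFull M := by
    obtain ⟨p, q, hpq, hspan⟩ := S.exists_basis_of_isFull hJ.1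
    obtain ⟨u, hu, hu'⟩ := S.exists_isUnit_mem hc hpq (by rw [hspan]; exact hJ.2)
    rw [hspan] at hu
    have hv : β * u ^ 3 ∈ M := mul_mem_scale β (Submodule.pow_mem_pow J hu 3)
    have hv' := Submodule.mul_mem_mul (S.gen_mem c) hv
    rw [hOM, mul_comm] at hv'
    refine S.isFull_of_det_ne_zero (fg_scale β (hJ.1.1.pow 3)) hv hv' ?_
    rw [← mul_one (β * u ^ 3), mul_assoc (β * u ^ 3), one_mul, S.det_mul, S.det_one_gen]
    have := (S.isUnit_iff _).1 (hβ.mul (hu'.pow 3))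
    positivity
  obtain ⟨p, q, hpq, hspan⟩ := S.exists_basis_of_isFull hMfull
  obtain ⟨βu, rfl⟩ := hβ
  obtain ⟨N', A', B', C', h'⟩ := S.exists_isNormalized hc hpq (by rw [hspan]; exact hOM)
    (b := scale ((βu⁻¹ : kˣ) : k) (Submodule.span ℤ {x, y} ^ 3)) (by
      rw [hspan, hM, scale_mul_scale, ← mul_pow, mul_comm J, hJa, Units.mul_inv, scale_one,
        pow_three, quadOrderModule_mul_self, quadOrderModule_mul_self])
  have e1 := h'.mul_conjModule hc
  rw [← hspan, h'.idealNorm_eq hc]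
  have hN := h.pos
  refine S.scale_quadOrder_inj (c := c) h'.pos
    (div_pos (abs_pos.2 hNβ) (by positivity)) ?_
  rw [← e1, hspan, hM, hJdef, scale_pow, scale_scale, conjModule_scale, conjModule_pow,
    S.conjModule_conjModule, scale_mul_scale, mul_comm (conjModule τ _ ^ 3), h.pow_three_mul hc,
    scale_scale, map_mul, map_pow, AlgEquiv.commutes]
  have e2 : (βu : k) * algebraMap ℚ k N⁻¹ ^ 3 * (τ (βu : k) * algebraMap ℚ k N⁻¹ ^ 3) *
      algebraMap ℚ k (N ^ 3) = algebraMap ℚ k (Algebra.norm ℚ (βu : k) / N ^ 3) := by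
    rw [mul_mul_mul_comm, S.mul_conj, ← map_pow, ← map_mul, ← map_mul, ← map_mul]
    congr 1
    field_simp
  rw [e2]
  rcases abs_choice (Algebra.norm ℚ (βu : k)) with h1 | h1 <;> rw [h1]
  rw [neg_div, map_neg, scale_neg]

/-- The value `Tr(w / (c δ N³))`; see `trace_div`. -/
noncomputable def coeff (S : QuadraticFrame k τ δ Δ) (c : ℕ) (N : ℚ) (w : k) : ℚ :=
  2 * S.im w / (c * N ^ 3)

/-- `β ∈ 𝔞³` if and only if the four coefficients of the form attached to `(𝔞, β)` are integral,
the middle ones after division by `3`: both say that `β 𝔞⁻³ ⊆ O_{k,c}`, the second one because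
`O_{k,c}` is its own dual for the pairing `Tr(z w / (c δ))`. -/
theorem IsNormalized.mem_pow_three_iff (hc : 1 ≤ c) (h : S.IsNormalized c x y N A B C) (β : k) :
    β ∈ Submodule.span ℤ {x, y} ^ 3 ↔
      (∃ l : ℤ, S.coeff c N (β * τ x ^ 3) = l) ∧
      (∃ l : ℤ, S.coeff c N (β * (τ x ^ 2 * τ y)) = l) ∧
      (∃ l : ℤ, S.coeff c N (β * (τ x * τ y ^ 2)) = l) ∧
      (∃ l : ℤ, S.coeff c N (β * τ y ^ 3) = l) := by
  set a := Submodule.span ℤ {x, y} with ha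
  set M := scale (β * algebraMap ℚ k (N ^ 3)⁻¹) (conjModule τ a ^ 3) with hM
  have hN := h.pos
  have hN3 : algebraMap ℚ k (N ^ 3)⁻¹ * algebraMap ℚ k (N ^ 3) = 1 := by
    rw [← map_mul, inv_mul_cancel₀ (by positivity), map_one]
  have haM : a ^ 3 * M = scale β (quadOrderModule k c) := by
    rw [hM, mul_scale, h.pow_three_mul hc, scale_scale, mul_assoc, hN3, mul_one]
  have hOM : quadOrderModule k c * M = M := by
    rw [hM, mul_scale, order_mul_pow_three (h.conj_order_mul hc)]
  have hβ_iff : β ∈ a ^ 3 ↔ M ≤ quadOrderModule k c := by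
    constructor
    · intro hβ z hz
      obtain ⟨w, hw, rfl⟩ := mem_scale.1 hz
      have h1 := Submodule.mul_mem_mul hβ hw
      rw [h.pow_three_mul hc] at h1
      obtain ⟨v, hv, hvw⟩ := mem_scale.1 h1
      have : β * algebraMap ℚ k (N ^ 3)⁻¹ * w = v := by
        linear_combination (-algebraMap ℚ k (N ^ 3)⁻¹) * hvw + v * hN3
      rwa [this]
    · intro hle
      have h1 : a ^ 3 * M ≤ a ^ 3 := by
        calc a ^ 3 * M ≤ a ^ 3 * quadOrderModule k c := mul_le_mul' le_rfl hle
          _ = a ^ 3 := by rw [mul_comm, order_mul_pow_three (h.order_mul hc)]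
      apply h1
      rw [haM]
      simpa using mul_mem_scale β (one_mem_quadOrderModule k c)
  have hM_iff : M ≤ quadOrderModule k c ↔ ∀ z ∈ M, ∃ l : ℤ, S.im z = l * (c / 2) := by
    constructor
    · intro hle z hz
      obtain ⟨m, l, -, h1⟩ := (S.mem_quadOrder_iff c z).1 (hle hz)
      exact ⟨l, h1⟩
    · intro hall z hz
      obtain ⟨l, hl⟩ := hall z hz
      have hz' := Submodule.mul_mem_mul (S.gen_mem c) hz
      rw [hOM, mul_comm] at hz'
      obtain ⟨m, hm⟩ := hall _ hz'
      exact S.mem_quadOrder_of_pairing hl hm hc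
  -- the elements `w` with integral `Tr(β w / (c δ N³))`
  let T : Submodule ℤ k :=
    { carrier := {w | ∃ l : ℤ, S.coeff c N (β * w) = l}
      add_mem' := by
        rintro v w ⟨l, hl⟩ ⟨m, hm⟩
        refine ⟨l + m, ?_⟩
        push_cast
        rw [← hl, ← hm, coeff, coeff, coeff, mul_add, S.im_add]; ring
      zero_mem' := ⟨0, by rw [coeff, mul_zero, S.im_zero]; simp⟩
      smul_mem' := by
        rintro r w ⟨l, hl⟩
        refine ⟨r * l, ?_⟩
        push_cast
        rw [← hl, coeff, coeff, zsmul_eq_mul, mul_left_comm, S.im_mul, S.re_intCast,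
          S.im_intCast]; ring }
  have him_iff : (∀ z ∈ M, ∃ l : ℤ, S.im z = l * (c / 2)) ↔ conjModule τ a ^ 3 ≤ T := by
    have hc0 : (c : ℚ) ≠ 0 := by positivity
    have key : ∀ w (l : ℤ), S.im (β * algebraMap ℚ k (N ^ 3)⁻¹ * w) = l * (c / 2) ↔
        S.coeff c N (β * w) = l := by
      intro w l
      rw [mul_assoc, mul_left_comm, S.im_algebraMap_mul, coeff]
      field_simp
    constructor
    · intro hall w hw
      obtain ⟨l, hl⟩ := hall _ (mul_mem_scale _ hw)
      exact ⟨l, (key w l).1 hl⟩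
    · intro hle z hz
      obtain ⟨w, hw, rfl⟩ := mem_scale.1 hz
      obtain ⟨l, hl⟩ := hle hw
      exact ⟨l, (key w l).2 hl⟩
  rw [hβ_iff, hM_iff, him_iff, ha, conjModule_span_pair, span_pair_pow_three_le_iff]
  rfl

theorem IsNormalized.mem_pairSet_iff (hc : 1 ≤ c) (h : S.IsNormalized c x y N A B C) {b : ℕ}
    (hb : 1 ≤ b) (β : k) :
    (Submodule.span ℤ {x, y}, β) ∈ PairSet k b c ↔
      |Algebra.norm ℚ β| = b * N ^ 3 ∧ β ∈ Submodule.span ℤ {x, y} ^ 3 := by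
  have hN := h.pos
  constructor
  · rintro ⟨-, h1, h2⟩
    have hβ : IsUnit β := isUnit_of_idealNorm_ne_zero (by
      rw [h2]
      have : (b : ℚ) ≠ 0 := by positivity
      exact this)
    rw [h.idealNorm_scale hc hβ] at h2
    refine ⟨?_, h1⟩
    rw [← h2]; field_simp
  · rintro ⟨h1, h2⟩
    have hβ : IsUnit β := by
      rw [S.isUnit_iff, ← abs_ne_zero, h1]; positivity
    refine ⟨⟨h.isFracIdeal hc, _, h.isFracIdeal_inv hc, h.mul_inv hc⟩, h2, ?_⟩
    rw [h.idealNorm_scale hc hβ, h1]; field_simp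

end Normalized

end QuadraticFrame
/-! ### Hessians -/

/-- The discriminant of a form with middle coefficients `3 y`, `3 z` is `-27` times the discriminant
of its Hessian `(y² - x₀ z, y z - x₀ x₃, z² - y x₃)`. -/
theorem CubicForm.disc_eq_hessian {f : CubicForm} {y z : ℤ} (hy : f.x1 = 3 * y)
    (hz : f.x2 = 3 * z) : f.disc = -27 * ((y * z - f.x0 * f.x3) ^ 2 -
      4 * (y ^ 2 - f.x0 * z) * (z ^ 2 - y * f.x3)) := by
  rw [CubicForm.disc, hy, hz]; ring

/-- Forms are determined by their values. -/
theorem CubicForm.ext_of_eval {f g : CubicForm} (h : ∀ u v : ℚ, f.eval u v = g.eval u v) :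
    f = g := by
  have h1 := h 1 0
  have h2 := h 0 1
  have h3 := h 1 1
  have h4 := h 1 (-1)
  simp only [CubicForm.eval] at h1 h2 h3 h4
  ext
  · have : (f.x0 : ℚ) = g.x0 := by linarith
    exact_mod_cast this
  · have : (f.x1 : ℚ) = g.x1 := by linarith
    exact_mod_cast this
  · have : (f.x2 : ℚ) = g.x2 := by linarith
    exact_mod_cast this
  · have : (f.x3 : ℚ) = g.x3 := by linarith
    exact_mod_cast this

theorem dualForms_smul_coe {n : ℤ} (γ : SL(2, ℤ)) (f : dualForms n) :
    ((γ • f : dualForms n) : CubicForm) = γ • (f : CubicForm) := rfl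

theorem mk_eq_mk_iff {n : ℤ} (f g : dualForms n) :
    (Quotient.mk _ f : DualOrbits n) = Quotient.mk _ g ↔
      ∃ γ : SL(2, ℤ), γ • (f : CubicForm) = g := by
  rw [Quotient.eq, MulAction.orbitRel_apply, MulAction.mem_orbit_iff]
  constructor
  · rintro ⟨γ, h⟩
    exact ⟨γ⁻¹, by rw [← h, dualForms_smul_coe, inv_smul_smul]⟩
  · rintro ⟨γ, h⟩
    exact ⟨γ⁻¹, Subtype.ext (by rw [dualForms_smul_coe, ← h, inv_smul_smul])⟩

/-- Every orbit in `L^∨(n)`, `n ≠ 0`, meets the forms whose Hessian has nonzero leading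
coefficient. -/
theorem exists_smul_hessian_ne_zero {n : ℤ} (hn : n ≠ 0) (f : dualForms n) :
    ∃ (γ : SL(2, ℤ)) (y z : ℤ), (γ • (f : CubicForm)).x1 = 3 * y ∧
      (γ • (f : CubicForm)).x2 = 3 * z ∧ y ^ 2 - (γ • (f : CubicForm)).x0 * z ≠ 0 := by
  obtain ⟨f, hf⟩ := f
  obtain ⟨⟨y, hy⟩, ⟨z, hz⟩, hd⟩ := id hf
  rw [CubicForm.disc_eq_hessian hy hz] at hd
  -- the Hessian is covariant: the leading coefficient of the transformed form is the value of the
  -- Hessian at the first row of `γ`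
  have key : ∀ γ : SL(2, ℤ), (y ^ 2 - f.x0 * z) * γ 0 0 ^ 2 +
      (y * z - f.x0 * f.x3) * γ 0 0 * γ 0 1 + (z ^ 2 - y * f.x3) * γ 0 1 ^ 2 ≠ 0 →
      ∃ (γ : SL(2, ℤ)) (y z : ℤ), (γ • f).x1 = 3 * y ∧
      (γ • f).x2 = 3 * z ∧ y ^ 2 - (γ • f).x0 * z ≠ 0 := by
    intro γ hγ
    obtain ⟨⟨y', hy'⟩, ⟨z', hz'⟩, -⟩ := (dualForms n).smul_mem γ hf
    refine ⟨γ, y', z', hy', hz', ?_⟩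
    have hdet : γ 0 0 * γ 1 1 - γ 0 1 * γ 1 0 = 1 := by
      rw [← Matrix.det_fin_two]; exact γ.det_coe
    have e : 9 * (y' ^ 2 - (γ • f).x0 * z') = 9 * ((γ 0 0 * γ 1 1 - γ 0 1 * γ 1 0) ^ 2 *
        ((y ^ 2 - f.x0 * z) * γ 0 0 ^ 2 +
        (y * z - f.x0 * f.x3) * γ 0 0 * γ 0 1 + (z ^ 2 - y * f.x3) * γ 0 1 ^ 2)) := by
      have e1 : 9 * (y' ^ 2 - (γ • f).x0 * z') =
          (γ • f).x1 ^ 2 - 3 * (γ • f).x0 * (γ • f).x2 := by rw [hy', hz']; ring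
      rw [e1]
      simp only [CubicForm.smul_def, hy, hz]
      ring
    rw [hdet, one_pow, one_mul] at e
    intro h0
    rw [h0] at e
    exact hγ (by linarith)
  by_cases hA : y ^ 2 - f.x0 * z = 0
  · by_cases hC : z ^ 2 - y * f.x3 = 0
    · refine key ⟨!![1, 1; 0, 1], by simp⟩ ?_
      have hB : y * z - f.x0 * f.x3 ≠ 0 := by
        intro hB
        rw [hA, hB, hC] at hd
        exact hn (by linarith)
      simpa [hA, hC] using hB
    · refine key ⟨!![0, 1; -1, 0], by simp⟩ ?_
      simpa using hC
  · refine key 1 ?_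
    simpa using hA

namespace QuadraticFrame

variable {k : Type*} [CommRing k] [Algebra ℚ k] {τ : k ≃ₐ[ℚ] k} {δ : k} {Δ : ℤ}
  (S : QuadraticFrame k τ δ Δ)

include S

/-! ### The form attached to a basis -/

theorem inverse_mul_delta {q : ℚ} (hq : q ≠ 0) :
    Ring.inverse (algebraMap ℚ k q * δ) = algebraMap ℚ k (q * Δ)⁻¹ * δ := by
  have hΔ : (Δ : ℚ) ≠ 0 := by exact_mod_cast S.disc_ne_zero
  have hu : IsUnit (algebraMap ℚ k q * δ) := ((isUnit_iff_ne_zero.2 hq).map _).mul S.isUnit_delta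
  apply hu.mul_left_cancel
  rw [Ring.mul_inverse_cancel _ hu]
  have h1 : (δ * δ : k) = algebraMap ℚ k Δ := by rw [← pow_two, S.sq]; simp
  rw [mul_mul_mul_comm, h1, ← map_mul, ← map_mul]
  have : q * (q * Δ)⁻¹ * Δ = 1 := by field_simp
  rw [this, map_one]

theorem trace_div {c : ℕ} (hc : 1 ≤ c) {N : ℚ} (hN : N ≠ 0) (β w : k) :
    Algebra.trace ℚ k (β * Ring.inverse (algebraMap ℚ k ((c : ℚ) * N ^ 3) * δ) * w) =
      S.coeff c N (β * w) := by
  have hΔ : (Δ : ℚ) ≠ 0 := by exact_mod_cast S.disc_ne_zero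
  have hc0 : (c : ℚ) ≠ 0 := by positivity
  rw [S.inverse_mul_delta (mul_ne_zero hc0 (pow_ne_zero _ hN)), S.trace_eq, coeff,
    mul_right_comm, mul_comm (β * w), mul_assoc, S.re_algebraMap_mul, S.re_mul, S.re_delta,
    S.im_delta]
  field_simp
  ring

theorem coeff_add (c : ℕ) (N : ℚ) (v w : k) :
    S.coeff c N (v + w) = S.coeff c N v + S.coeff c N w := by
  rw [coeff, coeff, coeff, S.im_add]; ring

theorem coeff_algebraMap_mul (c : ℕ) (N q : ℚ) (w : k) :
    S.coeff c N (algebraMap ℚ k q * w) = q * S.coeff c N w := by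
  rw [coeff, coeff, S.im_algebraMap_mul]; ring

theorem isAdmissibleBasis_iff {a : Submodule ℤ k} {β x y : k} :
    IsAdmissibleBasis τ δ a β x y ↔
      Submodule.span ℤ {x, y} = a ∧ 0 < Algebra.norm ℚ β * S.det x y := by
  rw [IsAdmissibleBasis, S.linearIndependent_iff]
  constructor
  · rintro ⟨-, h2, r, h3, h4⟩
    refine ⟨h2, ?_⟩
    rw [S.sub_conj_eq] at h3
    have h5 := S.algebraMap_injective (S.isUnit_delta.mul_right_cancel h3)
    rw [← h5] at h4
    linarith
  · rintro ⟨h2, h3⟩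
    exact ⟨right_ne_zero_of_mul h3.ne', h2, _, S.sub_conj_eq x y, by linarith⟩

theorem exists_isAdmissibleBasis {b c : ℕ} (hb : 1 ≤ b) (p : PairSet k b c) :
    ∃ x y : k, IsAdmissibleBasis τ δ p.1.1 p.1.2 x y := by
  obtain ⟨⟨a, β⟩, hinv, -, hnorm⟩ := p
  obtain ⟨x, y, hxy, hspan⟩ := S.exists_basis_of_isFull hinv.1.1
  have hβ : IsUnit β := isUnit_of_idealNorm_ne_zero (by
    rw [hnorm]; have : (b : ℚ) ≠ 0 := by positivity
    exact this)
  have h0 : Algebra.norm ℚ β * S.det x y ≠ 0 := mul_ne_zero ((S.isUnit_iff β).1 hβ) hxy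
  rcases lt_or_gt_of_ne h0 with h | h
  · refine ⟨y, x, S.isAdmissibleBasis_iff.2 ⟨by rw [Set.pair_comm]; exact hspan, ?_⟩⟩
    have : S.det y x = -S.det x y := by rw [det, det]; ring
    change 0 < Algebra.norm ℚ β * S.det y x
    rw [this]; linarith
  · exact ⟨x, y, S.isAdmissibleBasis_iff.2 ⟨hspan, h⟩⟩

theorem exists_isNormalized_of_mem {b c : ℕ} (hc : 1 ≤ c) {x y β : k} (hxy : S.det x y ≠ 0)
    (h : (Submodule.span ℤ {x, y}, β) ∈ PairSet k b c) :
    ∃ (N : ℚ) (A B C : ℤ), S.IsNormalized c x y N A B C := by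
  obtain ⟨⟨⟨-, hO⟩, J, -, hJ⟩, -, -⟩ := h
  exact S.exists_isNormalized hc hxy hO hJ

variable {S}

section

variable {c : ℕ} {x y β : k} {N : ℚ} {A B C : ℤ}

theorem IsNormalized.isFormOf_iff (hc : 1 ≤ c) (h : S.IsNormalized c x y N A B C)
    (f : CubicForm) : IsFormOf τ δ c (Submodule.span ℤ {x, y}) β x y f ↔
      (f.x0 : ℚ) = S.coeff c N (β * τ x ^ 3) ∧
      (f.x1 : ℚ) = 3 * S.coeff c N (β * (τ x ^ 2 * τ y)) ∧
      (f.x2 : ℚ) = 3 * S.coeff c N (β * (τ x * τ y ^ 2)) ∧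
      (f.x3 : ℚ) = S.coeff c N (β * τ y ^ 3) := by
  have key : ∀ u v : ℚ, Algebra.trace ℚ k (β * Ring.inverse (algebraMap ℚ k ((c : ℚ) *
      idealNorm (quadOrderModule k c) (Submodule.span ℤ {x, y}) ^ 3) * δ) *
        (algebraMap ℚ k u * τ x + algebraMap ℚ k v * τ y) ^ 3) =
      S.coeff c N (β * τ x ^ 3) * u ^ 3 + 3 * S.coeff c N (β * (τ x ^ 2 * τ y)) * u ^ 2 * v +
      3 * S.coeff c N (β * (τ x * τ y ^ 2)) * u * v ^ 2 + S.coeff c N (β * τ y ^ 3) * v ^ 3 := by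
    intro u v
    rw [h.idealNorm_eq hc, S.trace_div hc h.pos.ne']
    have e : β * (algebraMap ℚ k u * τ x + algebraMap ℚ k v * τ y) ^ 3 =
        algebraMap ℚ k (u ^ 3) * (β * τ x ^ 3) +
        algebraMap ℚ k (3 * u ^ 2 * v) * (β * (τ x ^ 2 * τ y)) +
        algebraMap ℚ k (3 * u * v ^ 2) * (β * (τ x * τ y ^ 2)) +
        algebraMap ℚ k (v ^ 3) * (β * τ y ^ 3) := by
      simp only [map_mul, map_pow, map_ofNat]; ring
    rw [e, S.coeff_add, S.coeff_add, S.coeff_add, S.coeff_algebraMap_mul,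
      S.coeff_algebraMap_mul, S.coeff_algebraMap_mul, S.coeff_algebraMap_mul]
    ring
  constructor
  · intro hf
    have h1 := (hf 1 0).trans (key 1 0)
    have h2 := (hf 0 1).trans (key 0 1)
    have h3 := (hf 1 1).trans (key 1 1)
    have h4 := (hf 1 (-1)).trans (key 1 (-1))
    simp only [CubicForm.eval] at h1 h2 h3 h4
    refine ⟨by linarith, by linarith, by linarith, by linarith⟩
  · rintro ⟨h0, h1, h2, h3⟩ u v
    rw [key, CubicForm.eval, h0, h1, h2, h3]

/-- The Hessian of the form attached to `(𝔞, β)` is `N(β) / N(𝔞)³` times the primitive norm form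
of the basis. -/
theorem IsNormalized.hessian (hc : 1 ≤ c) (h : S.IsNormalized c x y N A B C) :
    S.coeff c N (β * (τ x ^ 2 * τ y)) ^ 2 -
      S.coeff c N (β * τ x ^ 3) * S.coeff c N (β * (τ x * τ y ^ 2)) =
        Algebra.norm ℚ β / N ^ 3 * A ∧
    S.coeff c N (β * (τ x ^ 2 * τ y)) * S.coeff c N (β * (τ x * τ y ^ 2)) -
      S.coeff c N (β * τ x ^ 3) * S.coeff c N (β * τ y ^ 3) = Algebra.norm ℚ β / N ^ 3 * B ∧
    S.coeff c N (β * (τ x * τ y ^ 2)) ^ 2 -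
      S.coeff c N (β * (τ x ^ 2 * τ y)) * S.coeff c N (β * τ y ^ 3) =
        Algebra.norm ℚ β / N ^ 3 * C := by
  have hN := h.pos.ne'
  have hc0 : (c : ℚ) ≠ 0 := by positivity
  have hd : 4 * S.det x y ^ 2 = c ^ 2 * N ^ 2 := by
    rw [← sq_abs, h.abs_det]; ring
  have e1 : S.im (β * (τ x ^ 2 * τ y)) ^ 2 - S.im (β * τ x ^ 3) * S.im (β * (τ x * τ y ^ 2)) =
      Algebra.norm ℚ β * Algebra.norm ℚ x * S.det x y ^ 2 := by
    simp only [pow_succ, pow_zero, one_mul, S.im_mul, S.re_mul, S.re_conj, S.im_conj, S.norm_eq,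
      det]
    ring
  have e2 : S.im (β * (τ x ^ 2 * τ y)) * S.im (β * (τ x * τ y ^ 2)) -
      S.im (β * τ x ^ 3) * S.im (β * τ y ^ 3) =
      Algebra.norm ℚ β * (2 * S.re (x * τ y)) * S.det x y ^ 2 := by
    simp only [pow_succ, pow_zero, one_mul, S.im_mul, S.re_mul, S.re_conj, S.im_conj, S.norm_eq,
      det]
    ring
  have e3 : S.im (β * (τ x * τ y ^ 2)) ^ 2 - S.im (β * (τ x ^ 2 * τ y)) * S.im (β * τ y ^ 3) =
      Algebra.norm ℚ β * Algebra.norm ℚ y * S.det x y ^ 2 := by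
    simp only [pow_succ, pow_zero, one_mul, S.im_mul, S.re_mul, S.re_conj, S.im_conj, S.norm_eq,
      det]
    ring
  rw [h.norm_left] at e1
  rw [h.trace_mul] at e2
  rw [h.norm_right] at e3
  simp only [coeff]
  refine ⟨?_, ?_, ?_⟩
  · field_simp
    linear_combination 4 * e1 + Algebra.norm ℚ β * N * A * hd
  · field_simp
    linear_combination 4 * e2 + Algebra.norm ℚ β * N * B * hd
  · field_simp
    linear_combination 4 * e3 + Algebra.norm ℚ β * N * C * hd

end

end QuadraticFrame
namespace QuadraticFrame

variable {k : Type*} [CommRing k] [Algebra ℚ k] {τ : k ≃ₐ[ℚ] k} {δ : k} {Δ : ℤ}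
  {S : QuadraticFrame k τ δ Δ}

section

variable {b c : ℕ} {x y β : k} {N : ℚ} {A B C : ℤ}

/-- The Hessian of the form attached to `(𝔞, β)` is `± b` times the primitive norm form. -/
theorem IsNormalized.exists_sign_hessian (hb : 1 ≤ b) (hc : 1 ≤ c)
    (h : S.IsNormalized c x y N A B C) (hp : (Submodule.span ℤ {x, y}, β) ∈ PairSet k b c)
    {f : CubicForm} (hf : IsFormOf τ δ c (Submodule.span ℤ {x, y}) β x y f) {Y Z : ℤ}
    (hY : f.x1 = 3 * Y) (hZ : f.x2 = 3 * Z) :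
    ∃ e : ℤ, e ^ 2 = 1 ∧ Algebra.norm ℚ β = e * b * N ^ 3 ∧ Y ^ 2 - f.x0 * Z = e * b * A ∧
      Y * Z - f.x0 * f.x3 = e * b * B ∧ Z ^ 2 - Y * f.x3 = e * b * C := by
  have hN := h.pos
  obtain ⟨hnorm, -⟩ := (h.mem_pairSet_iff hc hb β).1 hp
  obtain ⟨e, he, heq⟩ : ∃ e : ℤ, e ^ 2 = 1 ∧ Algebra.norm ℚ β = e * b * N ^ 3 := by
    rcases abs_choice (Algebra.norm ℚ β) with h1 | h1 <;> rw [hnorm] at h1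
    · exact ⟨1, by norm_num, by rw [← h1]; push_cast; ring⟩
    · exact ⟨-1, by norm_num, by push_cast; linear_combination h1⟩
  obtain ⟨h0, h1, h2, h3⟩ := (h.isFormOf_iff hc f).1 hf
  rw [hY] at h1
  rw [hZ] at h2
  push_cast at h1 h2
  have h1' := mul_left_cancel₀ three_ne_zero h1
  have h2' := mul_left_cancel₀ three_ne_zero h2
  obtain ⟨g1, g2, g3⟩ := h.hessian (β := β) hc
  rw [← h0, ← h1', ← h2', heq] at g1
  rw [← h0, ← h1', ← h2', ← h3, heq] at g2
  rw [← h1', ← h2', ← h3, heq] at g3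
  have hq : (e * b * N ^ 3 : ℚ) / N ^ 3 = e * b := by field_simp
  rw [hq] at g1 g2 g3
  exact ⟨e, he, heq, by exact_mod_cast g1, by exact_mod_cast g2, by exact_mod_cast g3⟩

/-- The form attached to a pair `(𝔞, β)` lies in `L^∨(n)`. -/
theorem IsNormalized.exists_isFormOf (hb : 1 ≤ b) (hc : 1 ≤ c)
    (h : S.IsNormalized c x y N A B C) (hp : (Submodule.span ℤ {x, y}, β) ∈ PairSet k b c)
    {n : ℤ} (hn : ((b : ℤ) * (c : ℤ)) ^ 2 * Δ = n) :
    ∃ f : dualForms n, IsFormOf τ δ c (Submodule.span ℤ {x, y}) β x y f.1 := by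
  obtain ⟨-, hβ⟩ := (h.mem_pairSet_iff hc hb β).1 hp
  obtain ⟨⟨x0, h0⟩, ⟨Y, hY⟩, ⟨Z, hZ⟩, ⟨x3, h3⟩⟩ := (h.mem_pow_three_iff hc β).1 hβ
  have hf : IsFormOf τ δ c (Submodule.span ℤ {x, y}) β x y ⟨x0, 3 * Y, 3 * Z, x3⟩ := by
    rw [h.isFormOf_iff hc, h0, hY, hZ, h3]
    push_cast
    exact ⟨rfl, rfl, rfl, rfl⟩
  refine ⟨⟨_, ⟨Y, rfl⟩, ⟨Z, rfl⟩, ?_⟩, hf⟩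
  obtain ⟨e, he, -, g1, g2, g3⟩ := h.exists_sign_hessian hb hc hp hf rfl rfl
  rw [CubicForm.disc_eq_hessian rfl rfl, mul_assoc 4, g1, g2, g3, ← hn]
  linear_combination (-27 * b ^ 2 * (B ^ 2 - 4 * A * C)) * he - 27 * b ^ 2 * h.disc_eq

end

/-! ### Changes of the basis and of the representative -/

/-- A change of basis by `γ ∈ SL(2,ℤ)` transforms the form by `γ`. -/
theorem isFormOf_smul {c : ℕ} {a : Submodule ℤ k} {β x y : k} {f : CubicForm}
    (hf : IsFormOf τ δ c a β x y f) (γ : SL(2, ℤ)) :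
    IsFormOf τ δ c a β ((γ 0 0 : k) * x + (γ 0 1 : k) * y) ((γ 1 0 : k) * x + (γ 1 1 : k) * y)
      (γ • f) := by
  intro u v
  rw [CubicForm.eval_smul, hf]
  congr 2
  simp only [map_add, map_mul, map_intCast]
  ring

omit [Algebra ℚ k] in
theorem span_pair_smul (γ : SL(2, ℤ)) (x y : k) :
    Submodule.span ℤ {(γ 0 0 : k) * x + (γ 0 1 : k) * y, (γ 1 0 : k) * x + (γ 1 1 : k) * y} =
      Submodule.span ℤ {x, y} := by
  have hdet : (γ 0 0 * γ 1 1 - γ 0 1 * γ 1 0 : k) = 1 := by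
    have : γ 0 0 * γ 1 1 - γ 0 1 * γ 1 0 = 1 := by
      rw [← Matrix.det_fin_two]; exact γ.det_coe
    exact_mod_cast congrArg (Int.cast : ℤ → k) this
  apply le_antisymm <;> rw [span_pair_le_iff]
  · exact ⟨(mem_span_pair_iff _ _ _).2 ⟨_, _, rfl⟩, (mem_span_pair_iff _ _ _).2 ⟨_, _, rfl⟩⟩
  · refine ⟨(mem_span_pair_iff _ _ _).2 ⟨γ 1 1, -γ 0 1, ?_⟩,
      (mem_span_pair_iff _ _ _).2 ⟨-γ 1 0, γ 0 0, ?_⟩⟩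
    · push_cast
      linear_combination (-x) * hdet
    · push_cast
      linear_combination (-y) * hdet

variable (S)

include S

theorem isAdmissibleBasis_smul {a : Submodule ℤ k} {β x y : k}
    (h : IsAdmissibleBasis τ δ a β x y) (γ : SL(2, ℤ)) :
    IsAdmissibleBasis τ δ a β ((γ 0 0 : k) * x + (γ 0 1 : k) * y)
      ((γ 1 0 : k) * x + (γ 1 1 : k) * y) := by
  rw [S.isAdmissibleBasis_iff] at h ⊢
  have hdet : (γ 0 0 * γ 1 1 - γ 0 1 * γ 1 0 : ℚ) = 1 := by
    have : γ 0 0 * γ 1 1 - γ 0 1 * γ 1 0 = 1 := by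
      rw [← Matrix.det_fin_two]; exact γ.det_coe
    exact_mod_cast congrArg (Int.cast : ℤ → ℚ) this
  rw [span_pair_smul, S.det_comb, hdet, one_mul]
  exact h

/-- Two admissible bases differ by an element of `SL(2,ℤ)`: the determinant of the base change is
`± 1`, and the sign condition makes it positive. -/
theorem exists_smul_of_isAdmissibleBasis {a : Submodule ℤ k} {β x y x' y' : k}
    (h : IsAdmissibleBasis τ δ a β x y) (h' : IsAdmissibleBasis τ δ a β x' y') :
    ∃ γ : SL(2, ℤ), x' = (γ 0 0 : k) * x + (γ 0 1 : k) * y ∧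
      y' = (γ 1 0 : k) * x + (γ 1 1 : k) * y := by
  rw [S.isAdmissibleBasis_iff] at h h'
  obtain ⟨hs, hd⟩ := h
  obtain ⟨hs', hd'⟩ := h'
  have hx' : x' ∈ Submodule.span ℤ {x, y} := by rw [hs, ← hs']; exact mem_span_pair_left _ _
  have hy' : y' ∈ Submodule.span ℤ {x, y} := by rw [hs, ← hs']; exact mem_span_pair_right _ _
  have hx : x ∈ Submodule.span ℤ {x', y'} := by rw [hs', ← hs]; exact mem_span_pair_left _ _
  have hy : y ∈ Submodule.span ℤ {x', y'} := by rw [hs', ← hs]; exact mem_span_pair_right _ _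
  obtain ⟨p, q, hpq⟩ := (mem_span_pair_iff _ _ _).1 hx'
  obtain ⟨r, s, hrs⟩ := (mem_span_pair_iff _ _ _).1 hy'
  obtain ⟨p', q', hpq'⟩ := (mem_span_pair_iff _ _ _).1 hx
  obtain ⟨r', s', hrs'⟩ := (mem_span_pair_iff _ _ _).1 hy
  have e1 : S.det x' y' = (p * s - q * r) * S.det x y := by rw [hpq, hrs, S.det_comb]
  have e2 : S.det x y = (p' * s' - q' * r') * S.det x' y' := by
    conv_lhs => rw [hpq', hrs', S.det_comb]
  have hunit : (p' * s' - q' * r') * (p * s - q * r) = 1 := by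
    have h0 : S.det x y ≠ 0 := right_ne_zero_of_mul hd.ne'
    have : ((p' * s' - q' * r') * (p * s - q * r) : ℚ) = 1 :=
      mul_right_cancel₀ h0 (by rw [mul_assoc, ← e1, ← e2, one_mul])
    exact_mod_cast this
  have hpos : (0 : ℤ) < p * s - q * r := by
    rw [e1, mul_left_comm] at hd'
    have := (pos_iff_pos_of_mul_pos hd').2 hd
    exact_mod_cast this
  have hdet : p * s - q * r = 1 := by
    rcases Int.isUnit_iff.1 (IsUnit.of_mul_eq_one _ ((mul_comm _ _).trans hunit)) with h | h
    · exact h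
    · omega
  exact ⟨⟨!![p, q; r, s], by rw [Matrix.det_fin_two_of]; exact hdet⟩, by simpa using hpq,
    by simpa using hrs⟩

/-- The orbit of the form attached to a pair depends only on the class of the pair. Replacing
`(𝔞, β)` by `(ρ 𝔞, ρ³ β)` multiplies the form by the sign of `N(ρ)`, and `-1 ∈ SL(2,ℤ)` acts on
cubic forms by `-1`. -/
theorem exists_smul_eq_of_equiv {b c : ℕ} (hc : 1 ≤ c) {p q : PairSet k b c}
    (hpq : p ≈ q) {x y x' y' : k} (h : IsAdmissibleBasis τ δ p.1.1 p.1.2 x y)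
    (h' : IsAdmissibleBasis τ δ q.1.1 q.1.2 x' y') {f g : CubicForm}
    (hf : IsFormOf τ δ c p.1.1 p.1.2 x y f) (hg : IsFormOf τ δ c q.1.1 q.1.2 x' y' g) :
    ∃ γ : SL(2, ℤ), γ • f = g := by
  obtain ⟨⟨a, β⟩, hp⟩ := p
  obtain ⟨⟨a', β'⟩, hq⟩ := q
  obtain ⟨ρ, h1, h2⟩ := hpq
  dsimp only at h1 h2 h h' hf hg
  have hρ := (S.isUnit_iff (ρ : k)).1 ρ.isUnit
  obtain ⟨hs, hd⟩ := S.isAdmissibleBasis_iff.1 h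
  subst h1 h2 hs
  rw [scale_span_pair] at h' hg hq
  obtain ⟨N, A, B, C, hN⟩ := S.exists_isNormalized_of_mem hc (right_ne_zero_of_mul hd.ne') hp
  have hd' : S.det (ρ * x) (ρ * y) = Algebra.norm ℚ (ρ : k) * S.det x y := S.det_mul _ _ _
  have hd0 : S.det (ρ * x) (ρ * y) ≠ 0 := by
    rw [hd']; exact mul_ne_zero hρ (right_ne_zero_of_mul hd.ne')
  obtain ⟨N', A', B', C', hN'⟩ := S.exists_isNormalized_of_mem hc hd0 hq
  have hadm : IsAdmissibleBasis τ δ (Submodule.span ℤ {(ρ : k) * x, (ρ : k) * y}) ((ρ : k) ^ 3 * β)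
      (ρ * x) (ρ * y) := by
    refine S.isAdmissibleBasis_iff.2 ⟨rfl, ?_⟩
    rw [hd', map_mul, map_pow]
    have : Algebra.norm ℚ (ρ : k) ^ 3 * Algebra.norm ℚ β * (Algebra.norm ℚ (ρ : k) * S.det x y) =
      Algebra.norm ℚ (ρ : k) ^ 4 * (Algebra.norm ℚ β * S.det x y) := by ring
    rw [this]
    positivity
  obtain ⟨γ, rfl, rfl⟩ := S.exists_smul_of_isAdmissibleBasis hadm h'
  have hNN : N' = |Algebra.norm ℚ (ρ : k)| * N := by
    have e := hN'.abs_det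
    rw [hd', abs_mul, hN.abs_det] at e
    have hc0 : (c : ℚ) ≠ 0 := by positivity
    field_simp at e
    linarith
  -- the form of the scaled basis is `f` up to the sign `e` of the norm of `ρ`
  obtain ⟨e, he, hes⟩ : ∃ e : ℤ, (e = 1 ∨ e = -1) ∧
      ∀ w : k, S.coeff c N' (ρ ^ 3 * τ ρ ^ 3 * w) = e * S.coeff c N w := by
    have hN0 := hN.pos.ne'
    have hc0 : (c : ℚ) ≠ 0 := by positivity
    have e1 : (ρ : k) ^ 3 * τ ρ ^ 3 = algebraMap ℚ k (Algebra.norm ℚ (ρ : k) ^ 3) := by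
      rw [← mul_pow, S.mul_conj, map_pow]
    rcases abs_choice (Algebra.norm ℚ (ρ : k)) with h1 | h1
    · refine ⟨1, Or.inl rfl, fun w => ?_⟩
      rw [e1, S.coeff_algebraMap_mul, hNN, h1, coeff, coeff]
      field_simp
      push_cast; ring
    · refine ⟨-1, Or.inr rfl, fun w => ?_⟩
      rw [e1, S.coeff_algebraMap_mul, hNN, h1, coeff, coeff]
      field_simp
      push_cast; ring
  obtain ⟨c0, c1, c2, c3⟩ := (hN.isFormOf_iff hc f).1 hf
  have key : ∀ f' : CubicForm, (f'.x0 : ℚ) = e * f.x0 → (f'.x1 : ℚ) = e * f.x1 →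
      (f'.x2 : ℚ) = e * f.x2 → (f'.x3 : ℚ) = e * f.x3 →
      IsFormOf τ δ c (Submodule.span ℤ {(ρ : k) * x, (ρ : k) * y}) ((ρ : k) ^ 3 * β)
        (ρ * x) (ρ * y) f' := by
    intro f' g0 g1 g2 g3
    rw [hN'.isFormOf_iff hc, g0, g1, g2, g3, c0, c1, c2, c3]
    simp only [map_mul]
    refine ⟨?_, ?_, ?_, ?_⟩
    · rw [← hes]; congr 1; ring
    · rw [mul_left_comm, ← hes]; congr 2; ring
    · rw [mul_left_comm, ← hes]; congr 2; ring
    · rw [← hes]; congr 1; ring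
  have fin : ∀ f' : CubicForm, IsFormOf τ δ c (Submodule.span ℤ {(ρ : k) * x, (ρ : k) * y})
      ((ρ : k) ^ 3 * β) (ρ * x) (ρ * y) f' → γ • f' = g := fun f' hf' =>
    CubicForm.ext_of_eval fun u v => (isFormOf_smul hf' γ u v).trans (hg u v).symm
  rcases he with rfl | rfl
  · exact ⟨γ, fin f (key f (by simp) (by simp) (by simp) (by simp))⟩
  · refine ⟨γ * -1, ?_⟩
    rw [mul_smul]
    refine fin _ (key _ ?_ ?_ ?_ ?_) <;> simp [CubicForm.smul_def]

/-! ### Injectivity -/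

theorem eq_zero_of_im_mul {h x y : k} (hx : S.im (h * x) = 0) (hy : S.im (h * y) = 0)
    (hd : S.det x y ≠ 0) : h = 0 := by
  rw [S.im_mul] at hx hy
  apply S.ext
  · rw [S.re_zero]
    refine (mul_eq_zero.1 ?_).resolve_right hd
    rw [det]; linear_combination S.re x * hy - S.re y * hx
  · rw [S.im_zero]
    refine (mul_eq_zero.1 ?_).resolve_right hd
    rw [det]; linear_combination S.im y * hx - S.im x * hy

variable {S}

section

variable {b b' c c' : ℕ} {x y x' y' β β' : k} {N N' : ℚ} {A B C A' B' C' : ℤ}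

/-- The Hessian of the form determines the products `s x x^τ` and `s x y^τ` with
`s = N(β) / N(𝔞)⁴`, by the sign condition on an admissible basis. -/
theorem IsNormalized.products_eq (hb : 1 ≤ b) (hc : 1 ≤ c)
    (h : S.IsNormalized c x y N A B C) (hp : (Submodule.span ℤ {x, y}, β) ∈ PairSet k b c)
    (hadm : IsAdmissibleBasis τ δ (Submodule.span ℤ {x, y}) β x y)
    {f : CubicForm} (hf : IsFormOf τ δ c (Submodule.span ℤ {x, y}) β x y f) {Y Z : ℤ}
    (hY : f.x1 = 3 * Y) (hZ : f.x2 = 3 * Z) :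
    algebraMap ℚ k (Algebra.norm ℚ β / N ^ 4) * (x * τ x) =
        algebraMap ℚ k ((Y ^ 2 - f.x0 * Z : ℤ) : ℚ) ∧
      algebraMap ℚ k (Algebra.norm ℚ β / N ^ 4) * (x * τ y) =
        algebraMap ℚ k ((Y * Z - f.x0 * f.x3 : ℤ) / 2 : ℚ) +
          algebraMap ℚ k (-((b * c : ℕ) / 2 : ℚ)) * δ := by
  obtain ⟨e, he, hn, g1, g2, -⟩ := h.exists_sign_hessian hb hc hp hf hY hZ
  have hN := h.pos
  obtain ⟨-, hd⟩ := S.isAdmissibleBasis_iff.1 hadm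
  constructor
  · rw [S.mul_conj, ← map_mul, h.norm_left, hn, g1]
    congr 1
    push_cast
    field_simp
  · apply S.ext
    · have : S.re (x * τ y) = N * B / 2 := by rw [← h.trace_mul]; ring
      rw [S.re_algebraMap_mul, this, S.re_add, S.re_algebraMap, S.re_algebraMap_mul, S.re_delta,
        hn, g2]
      push_cast
      field_simp
      ring
    · rw [S.im_algebraMap_mul, im_mul_conj, S.im_add, S.im_algebraMap, S.im_algebraMap_mul,
        S.im_delta]
      have h1 : Algebra.norm ℚ β * S.det x y = b * N ^ 3 * (c * N / 2) := by
        rw [← abs_of_pos hd, abs_mul, h.abs_det, ((h.mem_pairSet_iff hc hb β).1 hp).1]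
      have h2 : Algebra.norm ℚ β / N ^ 4 * -S.det x y =
          -(Algebra.norm ℚ β * S.det x y) / N ^ 4 := by ring
      rw [h2, h1]
      push_cast
      field_simp
      ring

/-- A pair is determined up to equivalence by its form, if the Hessian of the form has nonzero
leading coefficient, i.e. if the first element `x` of the basis is a unit of `k`. -/
theorem IsNormalized.exists_units_of_isFormOf (hb : 1 ≤ b) (hc : 1 ≤ c)
    (h : S.IsNormalized c x y N A B C) (h' : S.IsNormalized c x' y' N' A' B' C')
    (hp : (Submodule.span ℤ {x, y}, β) ∈ PairSet k b c)
    (hp' : (Submodule.span ℤ {x', y'}, β') ∈ PairSet k b c)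
    (hadm : IsAdmissibleBasis τ δ (Submodule.span ℤ {x, y}) β x y)
    (hadm' : IsAdmissibleBasis τ δ (Submodule.span ℤ {x', y'}) β' x' y')
    {f : CubicForm} (hf : IsFormOf τ δ c (Submodule.span ℤ {x, y}) β x y f)
    (hf' : IsFormOf τ δ c (Submodule.span ℤ {x', y'}) β' x' y' f) {Y Z : ℤ}
    (hY : f.x1 = 3 * Y) (hZ : f.x2 = 3 * Z) (hne : Y ^ 2 - f.x0 * Z ≠ 0) :
    ∃ ρ : kˣ, scale (ρ : k) (Submodule.span ℤ {x, y}) = Submodule.span ℤ {x', y'} ∧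
      (ρ : k) ^ 3 * β = β' := by
  obtain ⟨r1, r2⟩ := h.products_eq hb hc hp hadm hf hY hZ
  obtain ⟨r1', r2'⟩ := h'.products_eq hb hc hp' hadm' hf' hY hZ
  have hN := h.pos
  have hN' := h'.pos
  have hc0 : (c : ℚ) ≠ 0 := by positivity
  set s := algebraMap ℚ k (Algebra.norm ℚ β / N ^ 4) with hs
  set s' := algebraMap ℚ k (Algebra.norm ℚ β' / N' ^ 4) with hs'
  have hunit : IsUnit (algebraMap ℚ k ((Y ^ 2 - f.x0 * Z : ℤ) : ℚ)) :=
    (isUnit_iff_ne_zero.2 (by exact_mod_cast hne)).map _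
  have hxu : IsUnit x := by
    rw [← r1] at hunit
    exact isUnit_of_mul_isUnit_left (isUnit_of_mul_isUnit_right hunit)
  rw [← r1'] at hunit
  have hs'u : IsUnit s' := isUnit_of_mul_isUnit_left hunit
  have hxu' : IsUnit x' := isUnit_of_mul_isUnit_left (isUnit_of_mul_isUnit_right hunit)
  have hτxu' : IsUnit (τ x') := hxu'.map τ
  have t1 : s * (x * τ x) = s' * (x' * τ x') := r1.trans r1'.symm
  have t2 : s * (τ x * y) = s' * (τ x' * y') := by
    have := congrArg τ (r2.trans r2'.symm)
    simpa only [hs, hs', map_mul, AlgEquiv.commutes, S.conj_conj] using this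
  obtain ⟨X, rfl⟩ := hxu
  obtain ⟨X', rfl⟩ := hxu'
  set ρ : kˣ := X' * X⁻¹ with hρ
  have hX' : (X' : k) = ρ * X := by rw [hρ]; simp
  have hy' : y' = ρ * y := by
    have e : y' * X = y * X' := by
      apply hτxu'.mul_left_cancel
      apply hs'u.mul_left_cancel
      linear_combination (y : k) * t1 - (X : k) * t2
    apply X.isUnit.mul_right_cancel
    rw [e, hX']; ring
  have hNN : N' = |Algebra.norm ℚ (ρ : k)| * N := by
    have e := h'.abs_det
    rw [hX', hy', S.det_mul, abs_mul, h.abs_det] at e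
    field_simp at e
    linarith
  have hρ0 := (S.isUnit_iff (ρ : k)).1 ρ.isUnit
  obtain ⟨c0, c1, -, -⟩ := (h.isFormOf_iff hc f).1 hf
  obtain ⟨c0', c1', -, -⟩ := (h'.isFormOf_iff hc f).1 hf'
  -- comparison of the coefficients of `u³` and `u² v`
  have hzero : (algebraMap ℚ k (N' ^ 3) * β - algebraMap ℚ k (N ^ 3) * β' * τ ρ ^ 3) *
      τ (X : k) ^ 2 = 0 := by
    have hd : S.det (τ (X : k)) (τ y) ≠ 0 := by
      have := h.det_ne_zero hc
      intro h0
      apply this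
      rw [det, S.re_conj, S.im_conj, S.re_conj, S.im_conj] at h0
      rw [det]; linarith
    refine S.eq_zero_of_im_mul ?_ ?_ hd
    · have e1 : (algebraMap ℚ k (N' ^ 3) * β - algebraMap ℚ k (N ^ 3) * β' * τ ρ ^ 3) *
          τ (X : k) ^ 2 * τ (X : k) = algebraMap ℚ k (N' ^ 3) * (β * τ (X : k) ^ 3) -
            algebraMap ℚ k (N ^ 3) * (β' * τ (X' : k) ^ 3) := by rw [hX', map_mul]; ring
      rw [e1, S.im_sub, S.im_algebraMap_mul, S.im_algebraMap_mul]
      have e2 := c0.symm.trans c0'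
      rw [coeff, coeff] at e2
      field_simp at e2
      linear_combination e2
    · have e1 : (algebraMap ℚ k (N' ^ 3) * β - algebraMap ℚ k (N ^ 3) * β' * τ ρ ^ 3) *
          τ (X : k) ^ 2 * τ y = algebraMap ℚ k (N' ^ 3) * (β * (τ (X : k) ^ 2 * τ y)) -
            algebraMap ℚ k (N ^ 3) * (β' * (τ (X' : k) ^ 2 * τ y')) := by
        rw [hX', hy', map_mul, map_mul]; ring
      rw [e1, S.im_sub, S.im_algebraMap_mul, S.im_algebraMap_mul]
      have e2 := c1.symm.trans c1'
      rw [coeff, coeff] at e2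
      field_simp at e2
      linear_combination e2
  have hβ : algebraMap ℚ k (N' ^ 3) * β = algebraMap ℚ k (N ^ 3) * β' * τ ρ ^ 3 := by
    have hu : IsUnit (τ (X : k) ^ 2) := (X.isUnit.map τ).pow 2
    exact sub_eq_zero.1 (hu.mul_left_eq_zero.1 hzero)
  have hβ2 : algebraMap ℚ k (|Algebra.norm ℚ (ρ : k)| ^ 3) * (ρ ^ 3 * β) =
      algebraMap ℚ k (Algebra.norm ℚ (ρ : k) ^ 3) * β' := by
    have hu : IsUnit (algebraMap ℚ k (N ^ 3)) :=
      (isUnit_iff_ne_zero.2 (pow_ne_zero 3 hN.ne')).map _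
    apply hu.mul_left_cancel
    have e3 := S.mul_conj (ρ : k)
    rw [hNN, mul_pow, map_mul] at hβ
    rw [map_pow (algebraMap ℚ k) (Algebra.norm ℚ (ρ : k)), ← e3]
    linear_combination (ρ : k) ^ 3 * hβ
  have hu3 : IsUnit (algebraMap ℚ k (Algebra.norm ℚ (ρ : k) ^ 3)) :=
    (isUnit_iff_ne_zero.2 (pow_ne_zero 3 hρ0)).map _
  rcases abs_choice (Algebra.norm ℚ (ρ : k)) with h1 | h1 <;> rw [h1] at hβ2
  · refine ⟨ρ, ?_, hu3.mul_left_cancel hβ2⟩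
    rw [scale_span_pair, hX', hy']
  · refine ⟨-ρ, ?_, ?_⟩
    · rw [Units.val_neg, scale_neg, scale_span_pair, hX', hy']
    · apply hu3.mul_left_cancel
      rw [← hβ2, Units.val_neg, Odd.neg_pow (by decide), Odd.neg_pow (by decide), map_neg]
      ring

/-- The form determines `b`, the content of its Hessian. -/
theorem IsNormalized.dvd_of_isFormOf (hb : 1 ≤ b) (hb' : 1 ≤ b') (hc : 1 ≤ c) (hc' : 1 ≤ c')
    (h : S.IsNormalized c x y N A B C) (h' : S.IsNormalized c' x' y' N' A' B' C')
    (hp : (Submodule.span ℤ {x, y}, β) ∈ PairSet k b c)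
    (hp' : (Submodule.span ℤ {x', y'}, β') ∈ PairSet k b' c')
    {f : CubicForm} (hf : IsFormOf τ δ c (Submodule.span ℤ {x, y}) β x y f)
    (hf' : IsFormOf τ δ c' (Submodule.span ℤ {x', y'}) β' x' y' f) {Y Z : ℤ}
    (hY : f.x1 = 3 * Y) (hZ : f.x2 = 3 * Z) : b ∣ b' := by
  obtain ⟨e, -, -, g1, g2, g3⟩ := h.exists_sign_hessian hb hc hp hf hY hZ
  obtain ⟨e', he', -, g1', g2', g3'⟩ := h'.exists_sign_hessian hb' hc' hp' hf' hY hZ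
  obtain ⟨u, v, w, huvw⟩ := h'.primitive
  rw [← Int.natCast_dvd_natCast]
  refine ⟨e' * e * (u * A + v * B + w * C), ?_⟩
  have k1 := g1.symm.trans g1'
  have k2 := g2.symm.trans g2'
  have k3 := g3.symm.trans g3'
  linear_combination (-e' * u) * k1 - e' * v * k2 - e' * w * k3 - b' * he' - e' ^ 2 * b' * huvw

end

end QuadraticFrame
namespace QuadraticFrame

variable {k : Type*} [CommRing k] [Algebra ℚ k] {τ : k ≃ₐ[ℚ] k} {δ : k} {Δ : ℤ}
  (S : QuadraticFrame k τ δ Δ)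

include S

/-! ### Surjectivity -/

/-- If `√(B² - 4 A C) = r δ` in `k`, then `r` is an integer: the element `(B + r δ) / 2` is a root
of a monic integral polynomial, so it lies in the maximal order. -/
theorem exists_int_of_disc_eq {A B C : ℤ} {r : ℚ} (h : ((B ^ 2 - 4 * A * C : ℤ) : ℚ) = r ^ 2 * Δ) :
    ∃ l : ℤ, r = l := by
  set z : k := algebraMap ℚ k (B / 2) + algebraMap ℚ k (r / 2) * δ with hz
  have hre : S.re z = B / 2 := by
    rw [hz, S.re_add, S.re_algebraMap, S.re_algebraMap_mul, S.re_delta]; ring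
  have him : S.im z = r / 2 := by
    rw [hz, S.im_add, S.im_algebraMap, S.im_algebraMap_mul, S.im_delta]; ring
  have hroot : z ^ 2 - (B : k) * z + ((A * C : ℤ) : k) = 0 := by
    push_cast at h
    apply S.ext
    · rw [S.re_add, S.re_sub, pow_two, S.re_mul, S.re_mul, S.re_intCast, S.im_intCast,
        S.re_intCast, S.re_zero, hre, him]
      push_cast
      linear_combination (-1 / 4 : ℚ) * h
    · rw [S.im_add, S.im_sub, pow_two, S.im_mul, S.im_mul, S.re_intCast, S.im_intCast,
        S.im_intCast, S.im_zero, hre, him]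
      ring
  have hint : z ∈ integralClosure ℤ k := by
    refine ⟨Polynomial.X ^ 2 - Polynomial.C B * Polynomial.X + Polynomial.C (A * C), ?_, ?_⟩
    · monicity!
    · simp only [Polynomial.eval₂_add, Polynomial.eval₂_sub, Polynomial.eval₂_mul,
        Polynomial.eval₂_pow, Polynomial.eval₂_X]
      rw [Polynomial.eval₂_C, Polynomial.eval₂_C, eq_intCast, eq_intCast]
      exact hroot
  obtain ⟨m, l, -, hl⟩ := (S.mem_integralClosure z).1 hint
  change S.im z = _ at hl
  exact ⟨l, by rw [him] at hl; linarith⟩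

/-- Every form in `L^∨(n)` whose Hessian has nonzero leading coefficient comes from a pair. If the
Hessian is `b (A, B, C)` with `(A, B, C)` primitive of discriminant `c² Δ`, then the ideal is
`ℤ A + ℤ (B + c δ) / 2`, and `β` is found from the first two coefficients of the form; the other two
satisfy the recursion with characteristic polynomial `A T² - B T + C`. -/
theorem exists_pair_of_form {n : ℤ} (hn : n ≠ 0) {r : ℚ} (hr : (n : ℚ) = r ^ 2 * Δ)
    {f : CubicForm} (hf : f ∈ dualForms n) {y z : ℤ} (hy : f.x1 = 3 * y) (hz : f.x2 = 3 * z)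
    (hne : y ^ 2 - f.x0 * z ≠ 0) :
    ∃ (i : BCIndex n Δ) (p : PairSet k i.1.1 i.1.2) (x₁ x₂ : k),
      IsAdmissibleBasis τ δ p.1.1 p.1.2 x₁ x₂ ∧ IsFormOf τ δ i.1.2 p.1.1 p.1.2 x₁ x₂ f := by
  have hd := hf.2.2
  rw [CubicForm.disc_eq_hessian hy hz] at hd
  have hd' := mul_left_cancel₀ (by norm_num : (-27 : ℤ) ≠ 0) hd
  obtain ⟨M, hM, A, B, C, hA, hB, hC, u, v, w, huvw⟩ := exists_primitive_triple
    ((y ^ 2 - f.x0 * z : ℤ) : ℚ) ((y * z - f.x0 * f.x3 : ℤ) : ℚ) ((z ^ 2 - y * f.x3 : ℤ) : ℚ)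
    (fun h => hne (by exact_mod_cast h.1))
  -- the content `b` of the Hessian
  obtain ⟨b, hb⟩ : ∃ b : ℕ, M = b := by
    have h1 : M = ((u * (y ^ 2 - f.x0 * z) + v * (y * z - f.x0 * f.x3) +
        w * (z ^ 2 - y * f.x3) : ℤ) : ℚ) := by
      have e : ((u * A + v * B + w * C : ℤ) : ℚ) = 1 := by exact_mod_cast huvw
      push_cast at e hA hB hC ⊢
      linear_combination (-M) * e - u * hA - v * hB - w * hC
    have h2 : 0 ≤ u * (y ^ 2 - f.x0 * z) + v * (y * z - f.x0 * f.x3) +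
        w * (z ^ 2 - y * f.x3) := by
      have := hM.le
      rw [h1] at this
      exact_mod_cast this
    obtain ⟨b, hb⟩ := Int.eq_ofNat_of_zero_le h2
    exact ⟨b, by rw [h1, hb]; simp⟩
  subst hb
  have hb1 : 1 ≤ b := by
    have : 0 < b := by exact_mod_cast hM
    omega
  have hA' : y ^ 2 - f.x0 * z = b * A := by exact_mod_cast hA
  have hB' : y * z - f.x0 * f.x3 = b * B := by exact_mod_cast hB
  have hC' : z ^ 2 - y * f.x3 = b * C := by exact_mod_cast hC
  have hnb : (b : ℤ) ^ 2 * (B ^ 2 - 4 * A * C) = n := by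
    rw [mul_assoc 4, hA', hB', hC'] at hd'
    linear_combination hd'
  have hA0 : A ≠ 0 := by
    rintro rfl
    exact hne (by rw [hA']; ring)
  -- the conductor `c`
  have hdisc : ((B ^ 2 - 4 * A * C : ℤ) : ℚ) = (r / b) ^ 2 * Δ := by
    rw [← hnb] at hr
    push_cast at hr ⊢
    field_simp
    linear_combination hr
  obtain ⟨l, hl⟩ := S.exists_int_of_disc_eq hdisc
  rw [hl] at hdisc
  have hdisc' : B ^ 2 - 4 * A * C = (l.natAbs : ℤ) ^ 2 * Δ := by
    rw [Int.natAbs_sq]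
    exact_mod_cast hdisc
  set c := l.natAbs with hcdef
  have hc1 : 1 ≤ c := by
    by_contra h0
    have : c = 0 := by omega
    rw [hdisc', this] at hnb
    exact hn (by rw [← hnb]; simp)
  -- the sign `e` of `A`
  obtain ⟨e, he, hAe⟩ : ∃ e : ℤ, e ^ 2 = 1 ∧ |(A : ℚ)| = e * A := by
    rcases abs_choice (A : ℚ) with h | h
    · exact ⟨1, by norm_num, by rw [h]; simp⟩
    · exact ⟨-1, by norm_num, by rw [h]; simp⟩
  have heq : (e : ℚ) ^ 2 = 1 := by exact_mod_cast he
  have hAq : (A : ℚ) ≠ 0 := by exact_mod_cast hA0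
  have hD : (B : ℚ) ^ 2 - 4 * A * C = c ^ 2 * Δ := by exact_mod_cast hdisc'
  set x₁ : k := algebraMap ℚ k A with hx₁
  set x₂ : k := algebraMap ℚ k (B / 2) + algebraMap ℚ k (c / 2) * δ with hx₂
  set β : k := algebraMap ℚ k (e * (f.x0 * B / 2 - A * y)) +
    algebraMap ℚ k (e * (c * f.x0 / 2)) * δ with hβ
  have re1 : S.re x₁ = A := S.re_algebraMap _
  have im1 : S.im x₁ = 0 := S.im_algebraMap _
  have re2 : S.re x₂ = B / 2 := by
    rw [hx₂, S.re_add, S.re_algebraMap, S.re_algebraMap_mul, S.re_delta]; ring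
  have im2 : S.im x₂ = c / 2 := by
    rw [hx₂, S.im_add, S.im_algebraMap, S.im_algebraMap_mul, S.im_delta]; ring
  have reβ : S.re β = e * (f.x0 * B / 2 - A * y) := by
    rw [hβ, S.re_add, S.re_algebraMap, S.re_algebraMap_mul, S.re_delta]; ring
  have imβ : S.im β = e * (c * f.x0 / 2) := by
    rw [hβ, S.im_add, S.im_algebraMap, S.im_algebraMap_mul, S.im_delta]; ring
  have hdet : S.det x₁ x₂ = A * c / 2 := by rw [det, re1, im1, re2, im2]; ring
  have hnorm : S.IsNormalized c x₁ x₂ |(A : ℚ)| (e * A) (e * B) (e * C) := by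
    refine ⟨abs_pos.2 hAq, ?_, ?_, ?_, ⟨e * u, e * v, e * w, ?_⟩, ?_⟩
    · rw [S.norm_eq, re1, im1, hAe]; push_cast
      linear_combination (-A ^ 2 : ℚ) * heq
    · rw [S.re_mul, S.re_conj, S.im_conj, re1, im1, re2, hAe]; push_cast
      linear_combination (-A * B : ℚ) * heq
    · rw [S.norm_eq, re2, im2, hAe]; push_cast
      linear_combination (-A * C : ℚ) * heq + (1 / 4 : ℚ) * hD
    · linear_combination e ^ 2 * huvw + he
    · rw [hdet, abs_div, abs_mul, abs_of_pos (by positivity : (0 : ℚ) < c),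
        abs_of_pos (two_pos : (0 : ℚ) < 2)]
      ring
  have hAb : (y : ℚ) ^ 2 - f.x0 * z = b * A := by exact_mod_cast hA'
  have rec1 : (A : ℚ) * z - B * y + C * f.x0 = 0 := by
    have h0 : (b : ℤ) * (A * z - B * y + C * f.x0) = 0 := by
      linear_combination (-z) * hA' + y * hB' - f.x0 * hC'
    have : A * z - B * y + C * f.x0 = 0 :=
      (mul_eq_zero.1 h0).resolve_left (by positivity)
    exact_mod_cast this
  have rec2 : (A : ℚ) * f.x3 - B * z + C * y = 0 := by
    have h0 : (b : ℤ) * (A * f.x3 - B * z + C * y) = 0 := by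
      linear_combination (-f.x3) * hA' + z * hB' - y * hC'
    have : A * f.x3 - B * z + C * y = 0 :=
      (mul_eq_zero.1 h0).resolve_left (by positivity)
    exact_mod_cast this
  have hnβ : Algebra.norm ℚ β = b * A ^ 3 := by
    rw [S.norm_eq, reβ, imβ]
    linear_combination ((f.x0 * B / 2 - A * y : ℚ) ^ 2 - Δ * (c * f.x0 / 2) ^ 2) * heq +
      (f.x0 ^ 2 / 4 : ℚ) * hD + A ^ 2 * hAb + A * f.x0 * rec1
  have he0 : (e : ℚ) ≠ 0 := by
    intro h0; rw [h0] at heq; norm_num at heq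
  have hA3 : (c * |(A : ℚ)| ^ 3 : ℚ) = c * (e * A ^ 3) := by
    rw [hAe]; linear_combination (c * e * A ^ 3 : ℚ) * heq
  have hc0 : (c : ℚ) ≠ 0 := by positivity
  have imsq : S.im (β * τ x₂) = e * c * A * y / 2 := by
    rw [S.im_mul, S.re_conj, S.im_conj, re2, im2, reβ, imβ]; ring
  have co0 : S.coeff c |(A : ℚ)| (β * τ x₁ ^ 3) = f.x0 := by
    have : β * τ x₁ ^ 3 = algebraMap ℚ k (A ^ 3) * β := by
      rw [hx₁, AlgEquiv.commutes, map_pow]; ring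
    rw [coeff, this, S.im_algebraMap_mul, imβ, hA3]
    field_simp
  have co1 : S.coeff c |(A : ℚ)| (β * (τ x₁ ^ 2 * τ x₂)) = y := by
    have : β * (τ x₁ ^ 2 * τ x₂) = algebraMap ℚ k (A ^ 2) * (β * τ x₂) := by
      rw [hx₁, AlgEquiv.commutes, map_pow]; ring
    rw [coeff, this, S.im_algebraMap_mul, imsq, hA3]
    field_simp
  -- `x₂^τ` is a root of `T² - B T + A C`
  have hroot : τ x₂ ^ 2 = algebraMap ℚ k B * τ x₂ - algebraMap ℚ k (A * C) := by
    apply S.ext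
    · rw [S.re_sub, pow_two, S.re_mul, S.re_algebraMap_mul, S.re_algebraMap, S.re_conj, S.im_conj,
        re2, im2]
      linear_combination (-1 / 4 : ℚ) * hD
    · rw [S.im_sub, pow_two, S.im_mul, S.im_algebraMap_mul, S.im_algebraMap, S.re_conj, S.im_conj,
        re2, im2]
      ring
  have co2 : S.coeff c |(A : ℚ)| (β * (τ x₁ * τ x₂ ^ 2)) = z := by
    have : β * (τ x₁ * τ x₂ ^ 2) = algebraMap ℚ k (B / A) * (β * (τ x₁ ^ 2 * τ x₂)) -
        algebraMap ℚ k (C / A) * (β * τ x₁ ^ 3) := by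
      rw [hroot, hx₁, AlgEquiv.commutes]
      have e1 : algebraMap ℚ k B = algebraMap ℚ k (B / A) * algebraMap ℚ k A := by
        rw [← map_mul]; congr 1; field_simp
      have e2 : algebraMap ℚ k (A * C) = algebraMap ℚ k (C / A) * algebraMap ℚ k A ^ 2 := by
        rw [← map_pow, ← map_mul]; congr 1; field_simp
      rw [e1, e2]; ring
    rw [this, sub_eq_add_neg, ← neg_mul, ← map_neg, S.coeff_add, S.coeff_algebraMap_mul,
      S.coeff_algebraMap_mul, co0, co1]
    field_simp
    linear_combination -rec1
  have co3 : S.coeff c |(A : ℚ)| (β * τ x₂ ^ 3) = f.x3 := by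
    have : β * τ x₂ ^ 3 = algebraMap ℚ k (B / A) * (β * (τ x₁ * τ x₂ ^ 2)) -
        algebraMap ℚ k (C / A) * (β * (τ x₁ ^ 2 * τ x₂)) := by
      rw [hx₁, AlgEquiv.commutes]
      have e1 : algebraMap ℚ k B = algebraMap ℚ k (B / A) * algebraMap ℚ k A := by
        rw [← map_mul]; congr 1; field_simp
      have e2 : algebraMap ℚ k (A * C) = algebraMap ℚ k (C / A) * algebraMap ℚ k A ^ 2 := by
        rw [← map_pow, ← map_mul]; congr 1; field_simp
      linear_combination β * τ x₂ * hroot + β * τ x₂ ^ 2 * e1 - β * τ x₂ * e2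
    rw [this, sub_eq_add_neg, ← neg_mul, ← map_neg, S.coeff_add, S.coeff_algebraMap_mul,
      S.coeff_algebraMap_mul, co2, co1]
    field_simp
    linear_combination -rec2
  have hpair : (Submodule.span ℤ {x₁, x₂}, β) ∈ PairSet k b c := by
    rw [hnorm.mem_pairSet_iff hc1 hb1, hnorm.mem_pow_three_iff hc1, co0, co1, co2, co3]
    refine ⟨?_, ⟨_, rfl⟩, ⟨_, rfl⟩, ⟨_, rfl⟩, ⟨_, rfl⟩⟩
    rw [hnβ, abs_mul, abs_pow, abs_of_pos hM]
  refine ⟨⟨(b, c), hb1, hc1, ?_⟩, ⟨_, hpair⟩, x₁, x₂, ?_, ?_⟩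
  · rw [← hnb, hdisc']; ring
  · refine S.isAdmissibleBasis_iff.2 ⟨rfl, ?_⟩
    change 0 < Algebra.norm ℚ β * S.det x₁ x₂
    rw [hnβ, hdet]
    have : (b * A ^ 3 * (A * c / 2) : ℚ) = b * A ^ 4 * c / 2 := by ring
    rw [this]; positivity
  · refine (hnorm.isFormOf_iff hc1 f).2 ⟨co0.symm, ?_, ?_, co3.symm⟩
    · rw [co1, hy]; push_cast; rfl
    · rw [co2, hz]; push_cast; rfl

/-! ### The bijection -/

theorem exists_form {n : ℤ} (i : BCIndex n Δ) (p : PairSet k i.1.1 i.1.2) {x y : k}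
    (h : IsAdmissibleBasis τ δ p.1.1 p.1.2 x y) :
    ∃ f : dualForms n, IsFormOf τ δ i.1.2 p.1.1 p.1.2 x y f.1 := by
  obtain ⟨⟨b, c⟩, hb, hc, hbc⟩ := i
  obtain ⟨⟨a, β⟩, hp⟩ := p
  obtain ⟨hs, hd⟩ := S.isAdmissibleBasis_iff.1 h
  dsimp only at hs hd hp hb hc hbc
  subst hs
  obtain ⟨N, A, B, C, hN⟩ := S.exists_isNormalized_of_mem hc (right_ne_zero_of_mul hd.ne') hp
  exact hN.exists_isFormOf hb hc hp hbc

/-- Two pairs with admissible bases that give the same form, whose Hessian has nonzero leading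
coefficient, have the same class. -/
theorem class_eq_of_isFormOf {n : ℤ} {i j : BCIndex n Δ} {p : PairSet k i.1.1 i.1.2}
    {q : PairSet k j.1.1 j.1.2} {x y x' y' : k}
    (h : IsAdmissibleBasis τ δ p.1.1 p.1.2 x y) (h' : IsAdmissibleBasis τ δ q.1.1 q.1.2 x' y')
    {f : CubicForm} (hf : IsFormOf τ δ i.1.2 p.1.1 p.1.2 x y f)
    (hf' : IsFormOf τ δ j.1.2 q.1.1 q.1.2 x' y' f) {Y Z : ℤ}
    (hY : f.x1 = 3 * Y) (hZ : f.x2 = 3 * Z) (hne : Y ^ 2 - f.x0 * Z ≠ 0) :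
    (⟨i, Quotient.mk _ p⟩ : PairClasses k n Δ) = ⟨j, Quotient.mk _ q⟩ := by
  obtain ⟨⟨b, c⟩, hb, hc, hbc⟩ := i
  obtain ⟨⟨b', c'⟩, hb', hc', hbc'⟩ := j
  obtain ⟨⟨a, β⟩, hp⟩ := p
  obtain ⟨⟨a', β'⟩, hq⟩ := q
  obtain ⟨hs, hd⟩ := S.isAdmissibleBasis_iff.1 h
  obtain ⟨hs', hd'⟩ := S.isAdmissibleBasis_iff.1 h'
  dsimp only at hs hd hp hb hc hbc hs' hd' hq hb' hc' hbc' hf hf' h h'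
  subst hs hs'
  obtain ⟨N, A, B, C, hN⟩ := S.exists_isNormalized_of_mem hc (right_ne_zero_of_mul hd.ne') hp
  obtain ⟨N', A', B', C', hN'⟩ := S.exists_isNormalized_of_mem hc' (right_ne_zero_of_mul hd'.ne') hq
  obtain rfl : b = b' := Nat.dvd_antisymm
    (hN.dvd_of_isFormOf hb hb' hc hc' hN' hp hq hf hf' hY hZ)
    (hN'.dvd_of_isFormOf hb' hb hc' hc hN hq hp hf' hf hY hZ)
  obtain rfl : c = c' := by
    have h1 := mul_right_cancel₀ S.disc_ne_zero (hbc.trans hbc'.symm)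
    have h2 : (b * c) ^ 2 = (b * c') ^ 2 := by exact_mod_cast h1
    exact Nat.eq_of_mul_eq_mul_left hb (Nat.pow_left_injective two_ne_zero h2)
  congr 1
  exact Quotient.sound (hN.exists_units_of_isFormOf hb hc hN' hp hq h h' hf hf' hY hZ hne)

/-- The map `Ψ_n` exists and is bijective as soon as `n` is a rational square times `Δ`. -/
theorem exists_isPsi_bijective {n : ℤ} (hn : n ≠ 0) {r : ℚ} (hr : (n : ℚ) = r ^ 2 * Δ) :
    ∃ Ψ : PairClasses k n Δ → DualOrbits n, IsPsi n Δ τ δ Ψ ∧ Function.Bijective Ψ := by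
  choose x y hxy using fun (i : BCIndex n Δ) (p : PairSet k i.1.1 i.1.2) =>
    S.exists_isAdmissibleBasis i.2.1 p
  choose F hF using fun (i : BCIndex n Δ) (p : PairSet k i.1.1 i.1.2) =>
    S.exists_form i p (hxy i p)
  let Ψ : PairClasses k n Δ → DualOrbits n := fun s =>
    Quotient.lift (fun p => (Quotient.mk _ (F s.1 p) : DualOrbits n)) (fun p q hpq =>
      (mk_eq_mk_iff _ _).2 (S.exists_smul_eq_of_equiv s.1.2.2.1 hpq (hxy _ p) (hxy _ q)
        (hF _ p) (hF _ q))) s.2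
  have hΨ : IsPsi n Δ τ δ Ψ := by
    intro i p
    refine ⟨⟨_, _, hxy i p⟩, fun x₁ x₂ h => ?_⟩
    obtain ⟨f, hf⟩ := S.exists_form i p h
    exact ⟨f, hf, (mk_eq_mk_iff _ _).2 (S.exists_smul_eq_of_equiv i.2.2.1 (Setoid.refl p)
      (hxy i p) h (hF i p) hf)⟩
  refine ⟨Ψ, hΨ, ?_, ?_⟩
  · rintro ⟨i, P⟩ ⟨j, Q⟩ hPQ
    induction P using Quotient.inductionOn with | _ p
    induction Q using Quotient.inductionOn with | _ q
    obtain ⟨γ, hγ⟩ := (mk_eq_mk_iff (F i p) (F j q)).1 hPQ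
    -- move both forms to the same form with nonzero leading coefficient of the Hessian
    obtain ⟨g, Y, Z, hY, hZ, hne⟩ := exists_smul_hessian_ne_zero hn (F j q)
    have hfp := isFormOf_smul (hF i p) (g * γ)
    rw [mul_smul, hγ] at hfp
    exact S.class_eq_of_isFormOf (S.isAdmissibleBasis_smul (hxy i p) (g * γ))
      (S.isAdmissibleBasis_smul (hxy j q) g) hfp (isFormOf_smul (hF j q) g) hY hZ hne
  · intro O
    induction O using Quotient.inductionOn with | _ f
    obtain ⟨g, Y, Z, hY, hZ, hne⟩ := exists_smul_hessian_ne_zero hn f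
    obtain ⟨i, p, x₁, x₂, hadm, hform⟩ := S.exists_pair_of_form hn hr
      ((dualForms n).smul_mem g f.2) hY hZ hne
    refine ⟨⟨i, Quotient.mk _ p⟩, ?_⟩
    obtain ⟨f', hf', hΨf⟩ := (hΨ i p).2 x₁ x₂ hadm
    rw [hΨf, mk_eq_mk_iff]
    refine ⟨g⁻¹, ?_⟩
    rw [CubicForm.ext_of_eval fun u v => (hf' u v).trans (hform u v).symm, inv_smul_smul]

end QuadraticFrame
/-! ### The frame of `ℚ × ℚ` -/

theorem conj_neg_one_one {τ : (ℚ × ℚ) ≃ₐ[ℚ] (ℚ × ℚ)} (hτ : τ ≠ AlgEquiv.refl) :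
    τ ((-1, 1) : ℚ × ℚ) = -((-1, 1) : ℚ × ℚ) := by
  have hidem : τ (1, 0) * τ (1, 0) = τ (1, 0) := by rw [← map_mul]; simp
  have hδ : τ ((-1, 1) : ℚ × ℚ) = 1 - 2 * τ (1, 0) := by
    have : ((-1, 1) : ℚ × ℚ) = 1 - 2 * (1, 0) := by ext <;> norm_num
    rw [this, map_sub, map_one, map_mul, map_ofNat]
  obtain ⟨⟨p, q⟩, hpq⟩ : ∃ w, τ (1, 0) = w := ⟨_, rfl⟩
  rw [hpq] at hidem hδ
  have hp : p = 0 ∨ p = 1 := by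
    have : p * p = p := congrArg Prod.fst hidem
    rcases mul_eq_zero.1 (show p * (p - 1) = 0 by linarith) with h | h
    · exact Or.inl h
    · exact Or.inr (by linarith)
  have hq : q = 0 ∨ q = 1 := by
    have : q * q = q := congrArg Prod.snd hidem
    rcases mul_eq_zero.1 (show q * (q - 1) = 0 by linarith) with h | h
    · exact Or.inl h
    · exact Or.inr (by linarith)
  rcases hp with rfl | rfl <;> rcases hq with rfl | rfl
  · have : ((1, 0) : ℚ × ℚ) = 0 := τ.injective (hpq.trans (map_zero τ).symm)
    simp at this
  · rw [hδ]; ext <;> norm_num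
  · -- `τ` fixes the idempotent `(1, 0)`, hence is the identity
    refine absurd (AlgEquiv.ext fun z => ?_) hτ
    have hz : z = z.1 • (1, 0) + z.2 • (1 - (1, 0)) := by ext <;> simp
    rw [hz, map_add, map_smul, map_smul, map_sub, map_one, hpq]
    rfl
  · have : ((1, 0) : ℚ × ℚ) = 1 := τ.injective (hpq.trans (map_one τ).symm)
    simp [Prod.ext_iff] at this

/-- The coordinates on `ℚ × ℚ` with respect to `(1, 1)` and `(-1, 1)`. -/
noncomputable def prodFrame {τ : (ℚ × ℚ) ≃ₐ[ℚ] (ℚ × ℚ)} (hτ : τ ≠ AlgEquiv.refl) :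
    QuadraticFrame (ℚ × ℚ) τ ((-1, 1) : ℚ × ℚ) 1 where
  basis := Module.Basis.ofEquivFun
    { toFun := fun z => ![(z.1 + z.2) / 2, (z.2 - z.1) / 2]
      invFun := fun v => (v 0 - v 1, v 0 + v 1)
      map_add' := fun z w => by
        ext i; fin_cases i <;> simp <;> ring
      map_smul' := fun r z => by
        ext i; fin_cases i <;> simp <;> ring
      left_inv := fun z => by ext <;> simp <;> ring
      right_inv := fun v => by
        ext i; fin_cases i <;> simp }
  basis_zero := by
    rw [Module.Basis.coe_ofEquivFun]; ext <;> simp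
  basis_one := by
    rw [Module.Basis.coe_ofEquivFun]; ext <;> simp
  sq := by ext <;> simp
  disc_ne_zero := one_ne_zero
  conj_delta := conj_neg_one_one hτ
  mem_integralClosure z := by
    obtain ⟨p, q⟩ := z
    simp only [Module.Basis.ofEquivFun_repr_apply, LinearEquiv.coe_mk, LinearMap.coe_mk,
      AddHom.coe_mk, Matrix.cons_val_zero, Matrix.cons_val_one]
    constructor
    · intro h
      have h1 : IsIntegral ℤ p := IsIntegral.map (AlgHom.fst ℤ ℚ ℚ) h
      have h2 : IsIntegral ℤ q := IsIntegral.map (AlgHom.snd ℤ ℚ ℚ) h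
      obtain ⟨a, rfl⟩ := IsIntegrallyClosed.isIntegral_iff.1 h1
      obtain ⟨b, rfl⟩ := IsIntegrallyClosed.isIntegral_iff.1 h2
      refine ⟨a, b - a, ?_, ?_⟩
      · simp; ring
      · simp
    · rintro ⟨m, l, h1, h2⟩
      have hp : p = m := by push_cast at h1; linarith
      have hq : q = m + l := by push_cast at h1; linarith
      have hint : IsIntegral ℤ ((0, 1) : ℚ × ℚ) := by
        refine ⟨Polynomial.X ^ 2 - Polynomial.X, by monicity!, ?_⟩
        ext <;> simp
      have : ((p, q) : ℚ × ℚ) = m • 1 + l • ((0, 1) : ℚ × ℚ) := by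
        ext <;> simp [hp, hq]
      rw [this]
      exact add_mem (zsmul_mem (one_mem _) m) (zsmul_mem hint l)

/-! ### The frame of a quadratic field -/

section Field

variable {k : Type*} [Field k]

/-- The basis `1, d` of a quadratic extension of `ℚ`. -/
noncomputable def pairBasis [Algebra ℚ k] (hk : Module.finrank ℚ k = 2) {d : k}
    (hd : ∀ q : ℚ, algebraMap ℚ k q ≠ d) : Module.Basis (Fin 2) ℚ k :=
  basisOfLinearIndependentOfCardEqFinrank (b := ![1, d])
    (by
      rw [LinearIndependent.pair_iff]
      intro p q h
      rw [Algebra.smul_def, Algebra.smul_def, mul_one] at h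
      have hq : q = 0 := by
        by_contra hq
        apply hd (-p / q)
        have hq' : algebraMap ℚ k q ≠ 0 := (map_ne_zero _).2 hq
        rw [map_div₀, div_eq_iff hq', map_neg]
        linear_combination -h
      rw [hq, map_zero, zero_mul, add_zero] at h
      exact ⟨(map_eq_zero _).1 h, hq⟩)
    (by rw [hk]; rfl)

theorem pairBasis_zero [Algebra ℚ k] (hk : Module.finrank ℚ k = 2) {d : k}
    (hd : ∀ q : ℚ, algebraMap ℚ k q ≠ d) : pairBasis hk hd 0 = 1 := by
  simp [pairBasis]

theorem pairBasis_one [Algebra ℚ k] (hk : Module.finrank ℚ k = 2) {d : k}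
    (hd : ∀ q : ℚ, algebraMap ℚ k q ≠ d) : pairBasis hk hd 1 = d := by
  simp [pairBasis]

theorem pairBasis_repr [Algebra ℚ k] (hk : Module.finrank ℚ k = 2) {d : k}
    (hd : ∀ q : ℚ, algebraMap ℚ k q ≠ d) (p q : ℚ) :
    (pairBasis hk hd).repr (algebraMap ℚ k p + algebraMap ℚ k q * d) 0 = p ∧
      (pairBasis hk hd).repr (algebraMap ℚ k p + algebraMap ℚ k q * d) 1 = q := by
  have : algebraMap ℚ k p + algebraMap ℚ k q * d =
      p • pairBasis hk hd 0 + q • pairBasis hk hd 1 := by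
    rw [pairBasis_zero, pairBasis_one, Algebra.smul_def, Algebra.smul_def, mul_one]
  rw [this]
  simp

theorem exists_eq_add_mul [Algebra ℚ k] (hk : Module.finrank ℚ k = 2) {d : k}
    (hd : ∀ q : ℚ, algebraMap ℚ k q ≠ d) (z : k) :
    ∃ p q : ℚ, z = algebraMap ℚ k p + algebraMap ℚ k q * d := by
  refine ⟨(pairBasis hk hd).repr z 0, (pairBasis hk hd).repr z 1, ?_⟩
  conv_lhs => rw [← (pairBasis hk hd).sum_repr z]
  rw [Fin.sum_univ_two, pairBasis_zero, pairBasis_one, Algebra.smul_def, Algebra.smul_def, mul_one]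

variable [NumberField k]

theorem algebraMap_ne_of_sq {n : ℤ} (hn : ¬ IsSquare n) {s : k} (hs : s ^ 2 = (n : k)) (q : ℚ) :
    algebraMap ℚ k q ≠ s := by
  rintro rfl
  apply hn
  rw [← Rat.isSquare_intCast_iff]
  refine ⟨q, ?_⟩
  apply (algebraMap ℚ k).injective
  rw [← pow_two, map_pow, hs]; simp

theorem finrank_eq_two {n : ℤ} (hn : ¬ IsSquare n) {s : k} (hs : s ^ 2 = (n : k))
    (htop : IntermediateField.adjoin ℚ {s} = ⊤) : Module.finrank ℚ k = 2 := by
  have hint : IsIntegral ℚ s := Algebra.IsIntegral.isIntegral s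
  rw [← IntermediateField.finrank_top', ← htop, IntermediateField.adjoin.finrank hint]
  apply le_antisymm
  · have h1 : Polynomial.aeval s (Polynomial.X ^ 2 - Polynomial.C (n : ℚ)) = 0 := by
      simp [hs]
    have hm : (Polynomial.X ^ 2 - Polynomial.C (n : ℚ)).Monic := by monicity!
    have := Polynomial.natDegree_le_natDegree (minpoly.min ℚ s hm h1)
    refine this.trans (le_of_eq ?_)
    compute_degree!
  · rw [minpoly.two_le_natDegree_iff hint]
    rintro ⟨q, hq⟩
    exact algebraMap_ne_of_sq hn hs q hq

theorem conj_eq_neg {n : ℤ} (hn : ¬ IsSquare n) {s : k} (hs : s ^ 2 = (n : k))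
    (hk : Module.finrank ℚ k = 2) {τ : k ≃ₐ[ℚ] k} (hτ : τ ≠ AlgEquiv.refl) : τ s = -s := by
  have h : τ s ^ 2 = s ^ 2 := by rw [← map_pow, hs, map_intCast]
  refine (sq_eq_sq_iff_eq_or_eq_neg.1 h).resolve_left fun h1 => hτ ?_
  ext z
  obtain ⟨p, q, rfl⟩ := exists_eq_add_mul hk (algebraMap_ne_of_sq hn hs) z
  rw [map_add, map_mul, h1, AlgEquiv.commutes, AlgEquiv.commutes]
  rfl

theorem exists_int_of_isIntegral {q : ℚ} (h : IsIntegral ℤ (algebraMap ℚ k q)) :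
    ∃ m : ℤ, q = m := by
  obtain ⟨m, hm⟩ := IsIntegrallyClosed.isIntegral_iff.1
    ((isIntegral_algebraMap_iff (algebraMap ℚ k).injective).1 h)
  exact ⟨m, by rw [← hm]; simp⟩

/-- The integers of a quadratic field `k`: if `δ² = Δ` is the discriminant of `k`, then an integral
element has the form `m + l (Δ + δ) / 2`, and `l = ± 1` occurs. -/
theorem exists_coords_of_discr {n : ℤ} (hn : ¬ IsSquare n) {s : k} (hs : s ^ 2 = (n : k))
    (hk : Module.finrank ℚ k = 2) {δ : k} (hδ : δ ^ 2 = (NumberField.discr k : k)) :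
    ∃ g : ℚ, g ≠ 0 ∧ δ = algebraMap ℚ k g * s ∧
      (∀ p q : ℚ, IsIntegral ℤ (algebraMap ℚ k p + algebraMap ℚ k q * δ) →
        ∃ l : ℤ, q = l / 2) ∧
      ∃ p q : ℚ, IsIntegral ℤ (algebraMap ℚ k p + algebraMap ℚ k q * δ) ∧ q ^ 2 = 1 / 4 := by
  have hsq := algebraMap_ne_of_sq hn hs
  have hrank : Module.finrank ℤ (NumberField.RingOfIntegers k) = 2 := by
    rw [NumberField.RingOfIntegers.rank, hk]
  let b := Module.finBasisOfFinrankEq ℤ (NumberField.RingOfIntegers k) hrank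
  obtain ⟨p₀, q₀, h₀⟩ := exists_eq_add_mul hk hsq (b 0 : k)
  obtain ⟨p₁, q₁, h₁⟩ := exists_eq_add_mul hk hsq (b 1 : k)
  have htr : ∀ p q : ℚ, Algebra.trace ℚ k (algebraMap ℚ k p + algebraMap ℚ k q * s) = 2 * p := by
    intro p q
    rw [trace_eq_two_mul_repr (pairBasis hk hsq) (pairBasis_zero hk hsq) (d := n)
      (by rw [pairBasis_one, hs]; simp), (pairBasis_repr hk hsq p q).1]
  have hmul : ∀ p q p' q' : ℚ, (algebraMap ℚ k p + algebraMap ℚ k q * s) *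
      (algebraMap ℚ k p' + algebraMap ℚ k q' * s) =
      algebraMap ℚ k (p * p' + n * q * q') + algebraMap ℚ k (p * q' + q * p') * s := by
    intro p q p' q'
    have : algebraMap ℚ k n = s ^ 2 := by rw [hs]; simp
    simp only [map_add, map_mul, this]
    ring
  -- the discriminant as the square of the determinant `E` of an integral basis
  set E := p₀ * q₁ - q₀ * p₁ with hE
  have hdisc : (NumberField.discr k : ℚ) = (2 * E) ^ 2 * n := by
    have hZ : ∀ z w : NumberField.RingOfIntegers k,
        ((Algebra.trace ℤ (NumberField.RingOfIntegers k) (z * w) : ℤ) : ℚ) =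
          Algebra.trace ℚ k ((z : k) * (w : k)) := fun z w => by
      rw [Algebra.coe_trace_int]
      exact congrArg _ (map_mul (algebraMap (NumberField.RingOfIntegers k) k) z w)
    rw [← NumberField.discr_eq_discr k b, Algebra.discr_def, Matrix.det_fin_two]
    simp only [Algebra.traceMatrix_apply, Algebra.traceForm_apply]
    push_cast
    rw [hZ, hZ, hZ, hZ, h₀, h₁, hmul, hmul, hmul, hmul, htr, htr, htr, htr]
    ring
  obtain ⟨g, hg, hgE⟩ : ∃ g : ℚ, δ = algebraMap ℚ k g * s ∧ g ^ 2 = (2 * E) ^ 2 := by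
    have h : δ ^ 2 = (algebraMap ℚ k (2 * E) * s) ^ 2 := by
      have : (NumberField.discr k : k) = algebraMap ℚ k (NumberField.discr k : ℚ) := by simp
      rw [hδ, this, hdisc, map_mul, map_pow, mul_pow, hs]; simp
    rcases sq_eq_sq_iff_eq_or_eq_neg.1 h with h | h
    · exact ⟨2 * E, h, rfl⟩
    · exact ⟨-(2 * E), by rw [h, map_neg, neg_mul], by ring⟩
  have hcoord : ∀ p q p' q' : ℚ, algebraMap ℚ k p + algebraMap ℚ k q * s =
      algebraMap ℚ k p' + algebraMap ℚ k q' * s → p = p' ∧ q = q' := by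
    intro p q p' q' h
    have h1 := pairBasis_repr hk hsq p q
    rw [h] at h1
    have h2 := pairBasis_repr hk hsq p' q'
    exact ⟨h1.1.symm.trans h2.1, h1.2.symm.trans h2.2⟩
  have hrepr : ∀ z : NumberField.RingOfIntegers k, (z : k) =
      algebraMap ℚ k (b.repr z 0 * p₀ + b.repr z 1 * p₁) +
        algebraMap ℚ k (b.repr z 0 * q₀ + b.repr z 1 * q₁) * s := by
    intro z
    have h2 := congrArg (algebraMap (NumberField.RingOfIntegers k) k) (b.sum_repr z)
    rw [Fin.sum_univ_two, map_add, zsmul_eq_mul, zsmul_eq_mul, map_mul, map_mul, map_intCast,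
      map_intCast] at h2
    change _ * (b 0 : k) + _ * (b 1 : k) = (z : k) at h2
    rw [h₀, h₁] at h2
    rw [← h2]
    simp only [map_add, map_mul, map_intCast]
    ring
  set u := b.repr 1 with hu
  obtain ⟨hu0, hu1⟩ : u 0 * p₀ + u 1 * p₁ = 1 ∧ u 0 * q₀ + u 1 * q₁ = 0 := by
    have h1 := hrepr 1
    refine hcoord _ _ 1 0 ?_
    rw [← h1]; simp
  have hg0 : g ≠ 0 := by
    rintro rfl
    have h2 : E = 0 := by
      have : (2 * E) ^ 2 = 0 := by rw [← hgE]; ring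
      simpa using this
    rw [h2] at hdisc
    have : NumberField.discr k = 0 := by
      have : (NumberField.discr k : ℚ) = 0 := by rw [hdisc]; ring
      exact_mod_cast this
    exact NumberField.discr_ne_zero k this
  have hE2 : ∃ e : ℤ, e ^ 2 = 1 ∧ E = e * g / 2 := by
    rcases sq_eq_sq_iff_eq_or_eq_neg.1 hgE with h | h
    · exact ⟨1, by norm_num, by rw [h]; push_cast; ring⟩
    · exact ⟨-1, by norm_num, by rw [h]; push_cast; ring⟩
  obtain ⟨e, he, hEe⟩ := hE2
  -- the coefficient of `δ` of an integer with coordinates `m` in the integral basis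
  have him : ∀ (z : NumberField.RingOfIntegers k) (p q : ℚ),
      (z : k) = algebraMap ℚ k p + algebraMap ℚ k q * δ →
      q = e * (u 0 * b.repr z 1 - u 1 * b.repr z 0 : ℤ) / 2 := by
    intro z p q hz
    have h1 := hrepr z
    rw [hz, hg, ← mul_assoc, ← map_mul] at h1
    obtain ⟨-, h2⟩ := hcoord _ _ _ _ h1
    have h3 : q * g = (u 0 * b.repr z 1 - u 1 * b.repr z 0) * E := by
      rw [h2, hE]
      linear_combination (-(b.repr z 0 * q₀ + b.repr z 1 * q₁) : ℚ) * hu0 +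
        (b.repr z 0 * p₀ + b.repr z 1 * p₁ : ℚ) * hu1
    rw [hEe] at h3
    apply mul_right_cancel₀ hg0
    rw [h3]; push_cast; ring
  refine ⟨g, hg0, hg, ?_, ?_⟩
  · intro p q h
    exact ⟨_, (him ⟨_, h⟩ p q rfl).trans (by rw [← Int.cast_mul])⟩
  · -- the coordinates of `1` in an integral basis are coprime
    have hcop : IsCoprime (u 0) (u 1) := by
      rw [Int.isCoprime_iff_gcd_eq_one]
      obtain ⟨x, hx⟩ := Int.gcd_dvd_left (u 0) (u 1)
      obtain ⟨y, hy⟩ := Int.gcd_dvd_right (u 0) (u 1)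
      set d := Int.gcd (u 0) (u 1) with hd
      have h1 : (1 : NumberField.RingOfIntegers k) =
          (d : NumberField.RingOfIntegers k) * (x • b 0 + y • b 1) := by
        have h2 := b.sum_repr 1
        rw [Fin.sum_univ_two, ← hu, hx, hy] at h2
        rw [← h2]
        simp only [zsmul_eq_mul]
        push_cast
        ring
      have hd0 : (d : ℚ) ≠ 0 := by
        intro h0
        have : d = 0 := by exact_mod_cast h0
        rw [this] at h1
        simp at h1
      have h3 : algebraMap ℚ k (d : ℚ)⁻¹ =
          ((x • b 0 + y • b 1 : NumberField.RingOfIntegers k) : k) := by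
        have h4 := congrArg (algebraMap (NumberField.RingOfIntegers k) k) h1
        rw [map_mul, map_one, map_natCast] at h4
        have hd1 : (d : k) ≠ 0 := by exact_mod_cast hd0
        rw [map_inv₀, map_natCast]
        exact inv_eq_of_mul_eq_one_right h4.symm
      obtain ⟨m, hm⟩ := exists_int_of_isIntegral (k := k) (q := (d : ℚ)⁻¹)
        (by rw [h3]; exact NumberField.RingOfIntegers.isIntegral_coe _)
      have h5 : (d : ℤ) * m = 1 := by
        have : (d : ℚ) * m = 1 := by rw [← hm, mul_inv_cancel₀ hd0]
        exact_mod_cast this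
      have h6 := Int.isUnit_iff.1 (IsUnit.of_mul_eq_one _ h5)
      omega
    obtain ⟨v, w, hvw⟩ := hcop
    let z : NumberField.RingOfIntegers k := (-w) • b 0 + v • b 1
    have hz0 : b.repr z 0 = -w := by
      change b.repr ((-w) • b 0 + v • b 1) 0 = -w
      rw [map_add, map_smul, map_smul, b.repr_self, b.repr_self]; simp
    have hz1 : b.repr z 1 = v := by
      change b.repr ((-w) • b 0 + v • b 1) 1 = v
      rw [map_add, map_smul, map_smul, b.repr_self, b.repr_self]; simp
    obtain ⟨p, q, hz⟩ := exists_eq_add_mul hk hsq (z : k)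
    have hz' : (z : k) = algebraMap ℚ k p + algebraMap ℚ k (q / g) * δ := by
      rw [hz, hg, ← mul_assoc, ← map_mul, div_mul_cancel₀ _ hg0]
    refine ⟨p, q / g, ?_, ?_⟩
    · rw [← hz']; exact NumberField.RingOfIntegers.isIntegral_coe z
    · rw [him z p (q / g) hz', hz0, hz1]
      have : u 0 * v - u 1 * -w = 1 := by linear_combination hvw
      rw [this]
      have heq : (e : ℚ) ^ 2 = 1 := by exact_mod_cast he
      push_cast
      linear_combination (1 / 4 : ℚ) * heq

theorem delta_ne_algebraMap {n : ℤ} (hn : ¬ IsSquare n) {s : k} (hs : s ^ 2 = (n : k))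
    {δ : k} {g : ℚ} (hg : g ≠ 0) (hδ : δ = algebraMap ℚ k g * s) (q : ℚ) :
    algebraMap ℚ k q ≠ δ := by
  intro h
  apply algebraMap_ne_of_sq hn hs (q / g)
  have : algebraMap ℚ k g ≠ 0 := (map_ne_zero _).2 hg
  rw [map_div₀, h, hδ]
  field_simp

/-- The coordinates on the quadratic field `ℚ(√n)` with respect to `1` and `δ = √Δ`. -/
noncomputable def fieldFrame {n : ℤ} (hn : ¬ IsSquare n) {s : k} (hs : s ^ 2 = (n : k))
    (hk : Module.finrank ℚ k = 2) {δ : k} (hδ : δ ^ 2 = (NumberField.discr k : k))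
    {τ : k ≃ₐ[ℚ] k} (hτ : τ ≠ AlgEquiv.refl) :
    QuadraticFrame k τ δ (NumberField.discr k) :=
  have hδne : ∀ q : ℚ, algebraMap ℚ k q ≠ δ := by
    obtain ⟨g, hg0, hg, -⟩ := exists_coords_of_discr hn hs hk hδ
    exact delta_ne_algebraMap hn hs hg0 hg
  have hconj : τ δ = -δ := by
    obtain ⟨g, -, hg, -⟩ := exists_coords_of_discr hn hs hk hδ
    rw [hg, map_mul, AlgEquiv.commutes, conj_eq_neg hn hs hk hτ]; ring
  { basis := pairBasis hk hδne
    basis_zero := pairBasis_zero hk hδne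
    basis_one := pairBasis_one hk hδne
    sq := hδ
    disc_ne_zero := NumberField.discr_ne_zero k
    conj_delta := hconj
    mem_integralClosure := by
      obtain ⟨-, -, -, hint, p', q', hz', hq'⟩ := exists_coords_of_discr hn hs hk hδ
      set Δ := NumberField.discr k with hΔdef
      have hΔ : (Δ : k) = algebraMap ℚ k (Δ : ℚ) := by simp
      -- integral elements have the expected coordinates, by their trace and norm
      have key : ∀ p q : ℚ, IsIntegral ℤ (algebraMap ℚ k p + algebraMap ℚ k q * δ) →
          ∃ m l : ℤ, p = m + l * (Δ / 2 : ℚ) ∧ q = l / 2 := by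
        intro p q h
        obtain ⟨l, hl⟩ := hint p q h
        have hτz : τ (algebraMap ℚ k p + algebraMap ℚ k q * δ) =
            algebraMap ℚ k p - algebraMap ℚ k q * δ := by
          rw [map_add, map_mul, hconj, AlgEquiv.commutes, AlgEquiv.commutes]; ring
        have h' : IsIntegral ℤ (algebraMap ℚ k p - algebraMap ℚ k q * δ) := by
          rw [← hτz]; exact h.map (τ.toAlgHom.restrictScalars ℤ)
        obtain ⟨t, ht⟩ := exists_int_of_isIntegral (k := k) (q := 2 * p) (by
          have e : algebraMap ℚ k (2 * p) = algebraMap ℚ k p + algebraMap ℚ k q * δ +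
              (algebraMap ℚ k p - algebraMap ℚ k q * δ) := by rw [map_mul, map_ofNat]; ring
          rw [e]; exact h.add h')
        obtain ⟨N, hN⟩ := exists_int_of_isIntegral (k := k) (q := p ^ 2 - Δ * q ^ 2) (by
          have e : algebraMap ℚ k (p ^ 2 - Δ * q ^ 2) =
              (algebraMap ℚ k p + algebraMap ℚ k q * δ) *
              (algebraMap ℚ k p - algebraMap ℚ k q * δ) := by
            rw [map_sub, map_mul, map_pow, map_pow, ← hΔ, ← hδ]; ring
          rw [e]; exact h.mul h')
        have hp : p = t / 2 := by linarith
        rw [hp, hl] at hN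
        have h4 : t ^ 2 - l ^ 2 * Δ = 4 * N := by
          have : (t ^ 2 - l ^ 2 * Δ : ℚ) = 4 * N := by linear_combination 4 * hN
          exact_mod_cast this
        have h5 : Even (t ^ 2 - l ^ 2 * Δ) := ⟨2 * N, by rw [h4]; ring⟩
        have h6 : Even (t - l * Δ) := by
          rw [Int.even_sub, Int.even_pow, Int.even_mul, Int.even_pow] at h5
          rw [Int.even_sub, Int.even_mul]
          simpa using h5
        obtain ⟨m, hm⟩ := h6
        refine ⟨m, l, ?_, hl⟩
        have : (t : ℚ) - l * Δ = m + m := by exact_mod_cast hm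
        rw [hp]; linear_combination this / 2
      obtain ⟨m', l', hp', hql'⟩ := key p' q' hz'
      have hl' : (l' : ℚ) ^ 2 = 1 := by
        rw [hql'] at hq'; linear_combination 4 * hq'
      intro z
      obtain ⟨p, q, rfl⟩ := exists_eq_add_mul hk hδne z
      obtain ⟨r0, r1⟩ := pairBasis_repr hk hδne p q
      rw [r0, r1]
      refine ⟨key p q, ?_⟩
      rintro ⟨m, l, hp, hq⟩
      have e : algebraMap ℚ k p + algebraMap ℚ k q * δ = ((m - l * l' * m' : ℤ) : k) +
          ((l * l' : ℤ) : k) * (algebraMap ℚ k p' + algebraMap ℚ k q' * δ) := by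
        have e0 : p = ((m - l * l' * m' : ℤ) : ℚ) + ((l * l' : ℤ) : ℚ) * p' := by
          rw [hp, hp']; push_cast; linear_combination (-(l * (Δ / 2)) : ℚ) * hl'
        have e1 : q = ((l * l' : ℤ) : ℚ) * q' := by
          rw [hq, hql']; push_cast; linear_combination (-(l / 2) : ℚ) * hl'
        rw [e0, e1, map_add, map_mul, map_mul, map_intCast, map_intCast]
        ring
      rw [e]
      exact add_mem (intCast_mem _ _) (mul_mem (intCast_mem _ _) hz') }

end Field
end OhnoNakagawa

theorem theorem3p1 (n : ℤ) (hn : n ≠ 0) :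
    (¬ IsSquare n →
      ∀ (k : Type*) [Field k] [NumberField k] (s : k),
        s ^ 2 = (n : k) → IntermediateField.adjoin ℚ {s} = ⊤ →
        ∀ τ : k ≃ₐ[ℚ] k, τ ≠ AlgEquiv.refl →
        ∀ δ : k, δ ^ 2 = (NumberField.discr k : k) →
        ∃ Ψ : OhnoNakagawa.PairClasses k n (NumberField.discr k) → OhnoNakagawa.DualOrbits n,
          OhnoNakagawa.IsPsi n (NumberField.discr k) τ δ Ψ ∧ Function.Bijective Ψ) ∧
    (IsSquare n →
      ∀ τ : (ℚ × ℚ) ≃ₐ[ℚ] (ℚ × ℚ), τ ≠ AlgEquiv.refl →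
        ∃ Ψ : OhnoNakagawa.PairClasses (ℚ × ℚ) n 1 → OhnoNakagawa.DualOrbits n,
          OhnoNakagawa.IsPsi n 1 τ ((-1, 1) : ℚ × ℚ) Ψ ∧ Function.Bijective Ψ) := by
  refine ⟨fun hsq k _ _ s hs htop τ hτ δ hδ => ?_, fun hsq τ hτ => ?_⟩
  · have hk := OhnoNakagawa.finrank_eq_two hsq hs htop
    obtain ⟨g, hg0, hg, -⟩ := OhnoNakagawa.exists_coords_of_discr hsq hs hk hδ
    refine (OhnoNakagawa.fieldFrame hsq hs hk hδ hτ).exists_isPsi_bijective hn (r := g⁻¹) ?_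
    -- `δ = g √n` gives `Δ = g² n`
    apply (algebraMap ℚ k).injective
    have h1 : algebraMap ℚ k (NumberField.discr k : ℚ) = algebraMap ℚ k g ^ 2 * (n : k) := by
      rw [← hs, ← mul_pow, ← hg, hδ]; simp
    have h2 : algebraMap ℚ k g ≠ 0 := (map_ne_zero _).2 hg0
    rw [map_mul, map_pow, map_inv₀, h1, map_intCast]
    field_simp
  · obtain ⟨m, rfl⟩ := hsq
    exact (OhnoNakagawa.prodFrame hτ).exists_isPsi_bijective hn (r := m) (by push_cast; ring)
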